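/- Let $A\in\mathbb{R}^{n\times n}$ and $B\in\mathbb{R}^{n\times m}$ be such that the plant $[A|B]$, $\dot x=Ax+Bu$, is unstable ($A$ is not Hurwitz) but stabilizable ($A+BF$ is Hurwitz, i.e. has all its eigenvalues in the open left half-plane, for some $F\in\mathbb{R}^{m\times n}$). Let $l\ge m$ and consider $l$ AWGN subchannels $p_i=q_i+d_i$ with noise power spectral densities $N_i>0$ and admissible input powers $P_i>0$; put $N=\mathrm{diag}(N_1,\dots,N_l)$, let $\mathfrak{C}_i=\frac12\frac{P_i}{N_i}$ be the subchannel capacities and $\mathfrak{C}=\sum_{i=1}^l\mathfrak{C}_i$ the total capacity. We say that $[A|B]$ is stabilizable via MIMO communication over these subchannels if there are a feedback gain $F\in\mathbb{R}^{m\times n}$, an encoder $T\in\mathbb{R}^{l\times m}$ and a decoder $R\in\mathbb{R}^{m\times l}$ with $RT=I$ such that the closed loop $v=Fx$, $q=Tv$, $u=R(q+d)$ is stable, i.e. $A+BRTF=A+BF$ is Hurwitz, and the power constraints $$\mathbf{E}[q_i^2]=\frac1{2\pi}\int_{-\infty}^{\infty}\{\boldsymbol{T}(j\omega)N\boldsymbol{T}(j\omega)^*\}_{ii}\,d\omega<P_i,\qquad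 i=1,\dots,l,$$ hold, where $\boldsymbol{T}(s)=TF(sI-A-BRTF)^{-1}BR$ is the closed-loop transfer function from $d$ to $q$. Let $H(A)=\sum_{\mathrm{Re}\,\lambda_i>0}\lambda_i$ be the topological entropy, where $\lambda_1,\dots,\lambda_n$ are the eigenvalues of $A$ with multiplicity. A cyclic decomposition of $A$ is a similarity $P^{-1}AP=\mathrm{diag}(A_1,\dots,A_k)$ with nonempty blocks $A_i$, each cyclic (its minimal polynomial $\alpha_i$ has degree equal to the size of $A_i$), such that $\alpha_1$ is the minimal polynomial of $A$ and $\alpha_{i+1}\mid\alpha_i$ for $1\le i<k$. (a) If the cyclic decomposition of $A$ has only one unstable cyclic block, namely $A_1$ (it is enough that $A_1$ is not Hurwitz and that $A_2,\dots,A_k$ have no eigenvalue with positive real part), then $[A|B]$ is stabilizable via MIMO communication over the AWGN subchannels if and only if $\mathfrak{C}>H(A)$. (b) This includes single-input plants: if $m=1$, then in every cyclic decomposition of $A$ the block $A_1$ is not Hurwitz and all the other blocks are Hurwitz, and $[A|B]$ is stabilizable via MIMO communication over the AWGN subchannels if and only if $\mathfrak{C}>H(A)$. -/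

import Mathlib

/-! Networked stabilization of a plant `[A|B]`, that is `x' = A x + B u`, by a static state feedback
`v = F x` that is transmitted to the plant through an encoder `T` (`q = T v`), `l` parallel
additive white Gaussian noise subchannels (`p = q + d`) and a decoder `R` (`u = R p`). -/

namespace MIMOControl

noncomputable section

/-- The complex eigenvalues of a real square matrix, repeated with algebraic multiplicity. -/
def eigenvalues {ι : Type*} [Fintype ι] [DecidableEq ι] (M : Matrix ι ι ℝ) : Multiset ℂ :=
  (M.map Complex.ofReal).charpoly.roots

/-- `M` is stable: all its eigenvalues lie in the open left half-plane. -/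
def IsHurwitz {ι : Type*} [Fintype ι] [DecidableEq ι] (M : Matrix ι ι ℝ) : Prop :=
  ∀ z ∈ eigenvalues M, z.re < 0

/-- The topological entropy `H(M)`: the sum of the eigenvalues with positive real part. Since the
nonreal ones come in conjugate pairs, this is the sum of their real parts. -/
def topologicalEntropy {ι : Type*} [Fintype ι] [DecidableEq ι] (M : Matrix ι ι ℝ) : ℝ :=
  (((eigenvalues M).filter fun z => 0 < z.re).map Complex.re).sum

/-- `M` is cyclic: the degree of its minimal polynomial is the size of `M`. -/
def IsCyclicMatrix {ι : Type*} [Fintype ι] [DecidableEq ι] (M : Matrix ι ι ℝ) : Prop :=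
  (minpoly ℝ M).natDegree = Fintype.card ι

/-- A cyclic decomposition of `A` with the `k + 1` blocks `block 0, …, block k`: `P⁻¹ A P` is block
diagonal with nonempty cyclic diagonal blocks, the first of which has the same minimal polynomial
as `A`, and the minimal polynomial of each block is divisible by that of the next one. -/
structure CyclicDecomposition {n : ℕ} (A : Matrix (Fin n) (Fin n) ℝ) where
  k : ℕ
  dim : Fin (k + 1) → ℕ
  dim_pos : ∀ i, 0 < dim i
  block : ∀ i, Matrix (Fin (dim i)) (Fin (dim i)) ℝ
  P : Matrix (Fin n) (Σ i, Fin (dim i)) ℝ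
  Pinv : Matrix (Σ i, Fin (dim i)) (Fin n) ℝ
  P_mul_Pinv : P * Pinv = 1
  Pinv_mul_P : Pinv * P = 1
  similar : Pinv * A * P = Matrix.blockDiagonal' block
  cyclic : ∀ i, IsCyclicMatrix (block i)
  minpoly_zero : minpoly ℝ (block 0) = minpoly ℝ A
  minpoly_dvd : ∀ i : Fin k, minpoly ℝ (block i.succ) ∣ minpoly ℝ (block i.castSucc)

/-- The first block is the only unstable one. Eigenvalues on the imaginary axis may or may not be
counted as unstable; to cover both conventions, the first block is only required not to be Hurwitz,
and the other blocks are only required to have no eigenvalue with positive real part. -/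
def CyclicDecomposition.OnlyFirstBlockUnstable {n : ℕ} {A : Matrix (Fin n) (Fin n) ℝ}
    (D : CyclicDecomposition A) : Prop :=
  ¬ IsHurwitz (D.block 0) ∧ ∀ i, i ≠ 0 → ∀ z ∈ eigenvalues (D.block i), z.re ≤ 0

/-- `[A|B]` is stabilizable (by state feedback over an ideal network). -/
def IsStabilizable {n m : ℕ} (A : Matrix (Fin n) (Fin n) ℝ) (B : Matrix (Fin n) (Fin m) ℝ) :
    Prop :=
  ∃ F : Matrix (Fin m) (Fin n) ℝ, IsHurwitz (A + B * F)

/-- The state matrix of the closed loop, `x' = (A + B R T F) x + B R d`. -/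
def closedLoop {n m l : ℕ} (A : Matrix (Fin n) (Fin n) ℝ) (B : Matrix (Fin n) (Fin m) ℝ)
    (F : Matrix (Fin m) (Fin n) ℝ) (T : Matrix (Fin l) (Fin m) ℝ) (R : Matrix (Fin m) (Fin l) ℝ) :
    Matrix (Fin n) (Fin n) ℝ :=
  A + B * R * T * F

/-- The complementary sensitivity function, i.e. the closed-loop transfer function from the noise
`d` to the channel input `q`: `T F (s I - A - B R T F)⁻¹ B R`. -/
def transferFunction {n m l : ℕ} (A : Matrix (Fin n) (Fin n) ℝ) (B : Matrix (Fin n) (Fin m) ℝ)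
    (F : Matrix (Fin m) (Fin n) ℝ) (T : Matrix (Fin l) (Fin m) ℝ) (R : Matrix (Fin m) (Fin l) ℝ)
    (s : ℂ) : Matrix (Fin l) (Fin l) ℂ :=
  (T * F).map Complex.ofReal
    * (s • (1 : Matrix (Fin n) (Fin n) ℂ) - (closedLoop A B F T R).map Complex.ofReal)⁻¹
    * (B * R).map Complex.ofReal

/-- The power spectral density (matrix) of the stationary channel input `q` at frequency `ω`, when
`d` is white noise with power spectral density `diag(N)`. -/
def inputPSD {n m l : ℕ} (A : Matrix (Fin n) (Fin n) ℝ) (B : Matrix (Fin n) (Fin m) ℝ)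
    (F : Matrix (Fin m) (Fin n) ℝ) (T : Matrix (Fin l) (Fin m) ℝ) (R : Matrix (Fin m) (Fin l) ℝ)
    (N : Fin l → ℝ) (ω : ℝ) : Matrix (Fin l) (Fin l) ℂ :=
  transferFunction A B F T R (Complex.I * ω) * Matrix.diagonal (fun i => (N i : ℂ))
    * (transferFunction A B F T R (Complex.I * ω)).conjTranspose

/-- The power `E[q_i²]` of the `i`-th stationary channel input: the integral over all frequencies
`ω` of its (real) power spectral density, divided by `2π`. If the closed loop is Hurwitz, the
integrand is continuous and `O(ω⁻²)`, hence integrable. -/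
def inputPower {n m l : ℕ} (A : Matrix (Fin n) (Fin n) ℝ) (B : Matrix (Fin n) (Fin m) ℝ)
    (F : Matrix (Fin m) (Fin n) ℝ) (T : Matrix (Fin l) (Fin m) ℝ) (R : Matrix (Fin m) (Fin l) ℝ)
    (N : Fin l → ℝ) (i : Fin l) : ℝ :=
  1 / (2 * Real.pi) * ∫ ω : ℝ, (inputPSD A B F T R N ω i i).re

/-- `[A|B]` is stabilizable via MIMO communication over AWGN subchannels with noise power spectral
densities `N i` and admissible input powers `Pow i`: a feedback gain and an encoder/decoder pair
with `R T = I` make the closed loop stable while every channel input obeys its power constraint. -/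
def IsStabilizableViaAWGN {n m l : ℕ} (A : Matrix (Fin n) (Fin n) ℝ) (B : Matrix (Fin n) (Fin m) ℝ)
    (N Pow : Fin l → ℝ) : Prop :=
  ∃ (F : Matrix (Fin m) (Fin n) ℝ) (T : Matrix (Fin l) (Fin m) ℝ) (R : Matrix (Fin m) (Fin l) ℝ),
    R * T = 1 ∧ IsHurwitz (closedLoop A B F T R) ∧ ∀ i, inputPower A B F T R N i < Pow i

/-- The capacity of an AWGN subchannel with noise density `N` and admissible input power `Pow`. -/
def capacity (N Pow : ℝ) : ℝ := 1 / 2 * (Pow / N)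

/-- The total capacity of the subchannels. -/
def totalCapacity {l : ℕ} (N Pow : Fin l → ℝ) : ℝ := ∑ i, capacity (N i) (Pow i)

end

end MIMOControl

open MIMOControl

/-! In the stable loop, put `M = A + B F` and `V = B R N^{1/2}`. The state covariance `X` solves `M
X + X Mᵀ + V Vᵀ = 0`, and the channel powers are the diagonal entries of `T F X (T F)ᵀ`
(`inputPower_eq`). The frequency integrals thus turn into matrix inequalities about Lyapunov
equations.

Necessity does not use cyclicity. Let `L` project onto the quotient `U` of `A` carrying the
eigenvalues with positive real part. By the Popov–Belevitch–Hautus (PBH) test `Y = L X Lᵀ` is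
invertible. Multiplying the projected Lyapunov equation by `Y⁻¹`, taking traces and completing a
square gives `∑ E[q_i²] / N_i ≥ 2 tr U = 2 H(A)` (`two_mul_trace_le_trace`).

For sufficiency, the feedback `-Vᵀ Y⁻¹` built from the Gramian `Y` of the slightly shifted unstable
part comes close to this bound. Its total normalised power is at most `tr (Vᵀ Y⁻¹ V)`, which is `2
H(A)` up to the shift (`exists_gramian`, `gramian_feedback`). The power must also be split as the
channels demand. If one input direction `k` controls all strictly unstable modes, giving the other
inputs a small weight `ε` concentrates nearly all the power in that direction
(`exists_feedback_of_input_direction`). An encoder with orthonormal columns then spreads it over the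
channels in proportion to their capacities (`isStabilizableViaAWGN_of_input_direction`).

Cyclicity supplies `k`: the strictly unstable left eigenspaces are lines, so the bad directions form
finitely many proper subspaces of the input space, which cannot cover it (`exists_input_direction`).
A single-input plant has `k = 1` directly from the PBH test. -/

namespace MIMOControl

open Matrix MeasureTheory Filter Topology

/-! ### Eigenvalues of real matrices -/

section Eigenvalues

variable {ι : Type*} [Fintype ι] [DecidableEq ι]

theorem mem_eigenvalues_iff_det (M : Matrix ι ι ℝ) (z : ℂ) :
    z ∈ eigenvalues M ↔ (z • (1 : Matrix ι ι ℂ) - M.map Complex.ofReal).det = 0 := by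
  unfold eigenvalues
  rw [Polynomial.mem_roots (Matrix.charpoly_monic _).ne_zero, Polynomial.IsRoot,
    Matrix.eval_charpoly, Matrix.scalar_apply, ← Matrix.smul_one_eq_diagonal]

theorem mem_eigenvalues_iff_mulVec (M : Matrix ι ι ℝ) (z : ℂ) :
    z ∈ eigenvalues M ↔ ∃ v ≠ 0, M.map Complex.ofReal *ᵥ v = z • v := by
  rw [mem_eigenvalues_iff_det, ← Matrix.exists_mulVec_eq_zero_iff]
  refine exists_congr fun v => and_congr_right fun _ => ?_
  rw [Matrix.sub_mulVec, Matrix.smul_mulVec, Matrix.one_mulVec, sub_eq_zero, eq_comm]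

theorem mem_eigenvalues_iff_vecMul (M : Matrix ι ι ℝ) (z : ℂ) :
    z ∈ eigenvalues M ↔ ∃ v ≠ 0, v ᵥ* M.map Complex.ofReal = z • v := by
  rw [mem_eigenvalues_iff_det, ← Matrix.exists_vecMul_eq_zero_iff]
  refine exists_congr fun v => and_congr_right fun _ => ?_
  rw [Matrix.vecMul_sub, Matrix.vecMul_smul, Matrix.vecMul_one, sub_eq_zero, eq_comm]

theorem re_sum_eigenvalues (M : Matrix ι ι ℝ) :
    ((eigenvalues M).map Complex.re).sum = M.trace := by
  have h := Matrix.trace_eq_sum_roots_charpoly (M.map Complex.ofReal)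
  have h2 : (M.map Complex.ofReal).trace = (M.trace : ℂ) := by
    simp [Matrix.trace]
  rw [h2] at h
  have := congrArg Complex.re h
  rw [Complex.ofReal_re] at this
  rw [this]
  exact (map_multiset_sum Complex.reAddGroupHom _).symm

end Eigenvalues

/-! ### Cauchy's theorem in the right half-plane -/

section HalfPlane

/-- Cauchy's theorem on the rectangle `[0, T] × [-T, T]`: the three sides off the imaginary axis
have total length `4T`, and there `‖f‖ ≤ K / T²`, so they contribute at most `4K / T`. -/
theorem integral_imaginary_axis_eq_zero {f : ℂ → ℂ} {K : ℝ}
    (hf : ∀ s : ℂ, 0 ≤ s.re → DifferentiableAt ℂ f s)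
    (hK : ∀ s : ℂ, 0 ≤ s.re → ‖f s‖ ≤ K / (1 + ‖s‖ ^ 2)) :
    Integrable (fun ω : ℝ => f (Complex.I * ω)) ∧ ∫ ω : ℝ, f (Complex.I * ω) = 0 := by
  have hK0 : 0 ≤ K := by
    have := (norm_nonneg _).trans (hK 0 (by simp))
    simpa using this
  have hcont : Continuous fun ω : ℝ => f (Complex.I * ω) := by
    rw [continuous_iff_continuousAt]
    intro ω
    have h1 : ContinuousAt f (Complex.I * ω) := (hf _ (by simp)).continuousAt
    exact ContinuousAt.comp (f := fun ω : ℝ => Complex.I * (ω : ℂ)) h1 (by fun_prop)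
  have hint : Integrable (fun ω : ℝ => f (Complex.I * ω)) := by
    refine (integrable_inv_one_add_sq.const_mul K).mono' hcont.aestronglyMeasurable ?_
    refine Eventually.of_forall fun ω => ?_
    have := hK (Complex.I * ω) (by simp)
    simpa [div_eq_mul_inv] using this
  refine ⟨hint, ?_⟩
  have hlim : Tendsto (fun T : ℝ => ∫ ω in (-T)..T, f (Complex.I * ω)) atTop
      (𝓝 (∫ ω : ℝ, f (Complex.I * ω))) :=
    intervalIntegral_tendsto_integral hint tendsto_neg_atTop_atBot tendsto_id
  have hbd : ∀ T : ℝ, 0 < T → ‖∫ ω in (-T)..T, f (Complex.I * ω)‖ ≤ 4 * K * T⁻¹ := by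
    intro T hT
    have hrect := Complex.integral_boundary_rect_eq_zero_of_differentiableOn f
      ⟨0, -T⟩ ⟨T, T⟩ (by
        intro s hs
        refine (hf s ?_).differentiableWithinAt
        have := hs.1
        simp only [Set.mem_preimage, Set.uIcc_of_le hT.le] at this
        exact this.1)
    simp only at hrect
    have key : ∀ s : ℂ, 0 ≤ s.re → T ≤ ‖s‖ → ‖f s‖ ≤ K * (T⁻¹ * T⁻¹) := by
      intro s hs hTs
      refine (hK s hs).trans ?_
      rw [div_eq_mul_inv, ← mul_inv]
      gcongr
      nlinarith
    have e1 : ‖∫ x in (0 : ℝ)..T, f (x + (-T : ℝ) * Complex.I)‖ ≤ K * (T⁻¹ * T⁻¹) * |T - 0| := by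
      apply intervalIntegral.norm_integral_le_of_norm_le_const
      intro x hx
      rw [Set.uIoc_of_le hT.le] at hx
      refine key _ (by simpa using hx.1.le) ?_
      refine le_trans ?_ (Complex.abs_im_le_norm _)
      simp [abs_of_pos hT]
    have e2 : ‖∫ x in (0 : ℝ)..T, f (x + (T : ℝ) * Complex.I)‖ ≤ K * (T⁻¹ * T⁻¹) * |T - 0| := by
      apply intervalIntegral.norm_integral_le_of_norm_le_const
      intro x hx
      rw [Set.uIoc_of_le hT.le] at hx
      refine key _ (by simpa using hx.1.le) ?_
      refine le_trans ?_ (Complex.abs_im_le_norm _)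
      simp [abs_of_pos hT]
    have e3 : ‖∫ y in (-T)..T, f ((T : ℝ) + (y : ℝ) * Complex.I)‖
        ≤ K * (T⁻¹ * T⁻¹) * |T - -T| := by
      apply intervalIntegral.norm_integral_le_of_norm_le_const
      intro y _
      refine key _ (by simpa using hT.le) ?_
      refine le_trans ?_ (Complex.abs_re_le_norm _)
      simp [abs_of_pos hT]
    have e4 : (∫ y in (-T)..T, f (((0 : ℝ) : ℂ) + (y : ℝ) * Complex.I))
        = ∫ ω in (-T)..T, f (Complex.I * ω) := by
      congr 1; ext y; simp [mul_comm]
    rw [e4, sub_eq_zero] at hrect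
    have := congrArg norm hrect
    rw [norm_smul, Complex.norm_I, one_mul] at this
    rw [← this]
    refine (norm_add_le _ _).trans ?_
    rw [norm_smul, Complex.norm_I, one_mul]
    have h3 := (norm_sub_le (∫ x in (0 : ℝ)..T, f (x + (-T : ℝ) * Complex.I))
      (∫ x in (0 : ℝ)..T, f (x + (T : ℝ) * Complex.I)))
    rw [sub_zero, abs_of_pos hT] at e1 e2
    rw [abs_of_pos (by linarith : 0 < T - -T)] at e3
    have h4 : T⁻¹ * T⁻¹ * T = T⁻¹ := by field_simp
    have h5 : K * (T⁻¹ * T⁻¹) * T = K * T⁻¹ := by rw [mul_assoc, h4]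
    have h6 : K * (T⁻¹ * T⁻¹) * (T - -T) = 2 * (K * T⁻¹) := by rw [← h5]; ring
    rw [h5] at e1 e2
    rw [h6] at e3
    linarith
  refine tendsto_nhds_unique hlim ?_
  have h0 : Tendsto (fun T : ℝ => 4 * K * T⁻¹) atTop (𝓝 0) := by
    simpa using tendsto_inv_atTop_zero.const_mul (4 * K)
  refine squeeze_zero_norm' ?_ h0
  filter_upwards [eventually_gt_atTop 0] with T hT using hbd T hT

end HalfPlane

/-! ### Resolvents of Hurwitz matrices -/

section Resolvent

variable {ι κ μ : Type*} [Fintype ι] [DecidableEq ι]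

/-- The resolvent `(s I - M)⁻¹` of a real matrix. -/
noncomputable def resolventMatrix (M : Matrix ι ι ℝ) (s : ℂ) : Matrix ι ι ℂ :=
  (s • (1 : Matrix ι ι ℂ) - M.map Complex.ofReal)⁻¹

theorem IsHurwitz.isUnit_det {M : Matrix ι ι ℝ} (hM : IsHurwitz M) {s : ℂ} (hs : 0 ≤ s.re) :
    IsUnit (s • (1 : Matrix ι ι ℂ) - M.map Complex.ofReal).det := by
  rw [isUnit_iff_ne_zero]
  intro h
  exact absurd (hM s ((mem_eigenvalues_iff_det M s).2 h)) (not_lt.2 hs)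

theorem IsHurwitz.mul_resolventMatrix {M : Matrix ι ι ℝ} (hM : IsHurwitz M) {s : ℂ}
    (hs : 0 ≤ s.re) :
    (s • (1 : Matrix ι ι ℂ) - M.map Complex.ofReal) * resolventMatrix M s = 1 :=
  Matrix.mul_nonsing_inv _ (hM.isUnit_det hs)

theorem IsHurwitz.resolventMatrix_mul {M : Matrix ι ι ℝ} (hM : IsHurwitz M) {s : ℂ}
    (hs : 0 ≤ s.re) :
    resolventMatrix M s * (s • (1 : Matrix ι ι ℂ) - M.map Complex.ofReal) = 1 :=
  Matrix.nonsing_inv_mul _ (hM.isUnit_det hs)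

open scoped Matrix.Norms.Operator in
theorem IsHurwitz.differentiableAt_resolventMatrix {M : Matrix ι ι ℝ} (hM : IsHurwitz M) {s : ℂ}
    (hs : 0 ≤ s.re) : DifferentiableAt ℂ (resolventMatrix M) s := by
  have h1 : resolventMatrix M = fun s : ℂ =>
      Ring.inverse (s • (1 : Matrix ι ι ℂ) - M.map Complex.ofReal) := by
    funext s
    rw [resolventMatrix, Matrix.nonsing_inv_eq_ringInverse]
  rw [h1]
  have hu : IsUnit (s • (1 : Matrix ι ι ℂ) - M.map Complex.ofReal) :=
    (Matrix.isUnit_iff_isUnit_det _).2 (hM.isUnit_det hs)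
  have hlin : DifferentiableAt ℂ
      (fun s : ℂ => s • (1 : Matrix ι ι ℂ) - M.map Complex.ofReal) s := by fun_prop
  exact DifferentiableAt.comp s
    (f := fun s : ℂ => s • (1 : Matrix ι ι ℂ) - M.map Complex.ofReal)
    (g := Ring.inverse) (differentiableAt_inverse hu) hlin

open scoped Matrix.Norms.Operator in
-- Continuity and compactness settle `‖s‖ ≤ 2a + 1`. For larger `s`, the identity `s R = 1 + M R`
-- gives `(‖s‖ - a) ‖R‖ ≤ ‖1‖`, and `‖s‖ - a ≥ (1 + ‖s‖) / 2`.
theorem IsHurwitz.exists_norm_resolventMatrix_le {M : Matrix ι ι ℝ} (hM : IsHurwitz M) :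
    ∃ K : ℝ, ∀ s : ℂ, 0 ≤ s.re → ‖resolventMatrix M s‖ * (1 + ‖s‖) ≤ K := by
  set a := ‖M.map Complex.ofReal‖ with ha
  set S : Set ℂ := Metric.closedBall 0 (2 * a + 1) ∩ {s | 0 ≤ s.re}
  have hS : IsCompact S := (isCompact_closedBall _ _).inter_right
    (isClosed_le continuous_const Complex.continuous_re)
  have hc : ContinuousOn (fun s => ‖resolventMatrix M s‖ * (1 + ‖s‖)) S := by
    intro s hs
    refine ContinuousAt.continuousWithinAt ?_
    have := (hM.differentiableAt_resolventMatrix hs.2).continuousAt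
    fun_prop
  obtain ⟨K, hK⟩ := hS.bddAbove_image hc
  refine ⟨max K (2 * ‖(1 : Matrix ι ι ℂ)‖), fun s hs => ?_⟩
  by_cases hsS : ‖s‖ ≤ 2 * a + 1
  · exact le_max_of_le_left (hK ⟨s, ⟨by simpa using hsS, hs⟩, rfl⟩)
  · refine le_max_of_le_right ?_
    push Not at hsS
    have h1 := hM.mul_resolventMatrix hs
    rw [sub_mul, smul_mul_assoc, one_mul, sub_eq_iff_eq_add] at h1
    have h2 := congrArg norm h1
    rw [norm_smul] at h2
    have h3 : ‖s‖ * ‖resolventMatrix M s‖ ≤ ‖(1 : Matrix ι ι ℂ)‖ + a * ‖resolventMatrix M s‖ := by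
      rw [h2]
      exact (norm_add_le _ _).trans (add_le_add_right (norm_mul_le _ _) _)
    have h4 : 0 ≤ ‖resolventMatrix M s‖ := norm_nonneg _
    nlinarith

open scoped Matrix.Norms.Operator in
/-- For a Hurwitz matrix `M`, the principal value of `∫ C (iω - M)⁻¹ W dω` is `π C W`. -/
theorem IsHurwitz.integral_re_resolventMatrix {M : Matrix ι ι ℝ} (hM : IsHurwitz M)
    (C : Matrix κ ι ℝ) (W : Matrix ι μ ℝ) (i : κ) (j : μ) :
    Integrable (fun ω : ℝ => ((C.map Complex.ofReal * resolventMatrix M (Complex.I * ω)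
      * W.map Complex.ofReal) i j).re) ∧
    ∫ ω : ℝ, ((C.map Complex.ofReal * resolventMatrix M (Complex.I * ω)
      * W.map Complex.ofReal) i j).re = Real.pi * (C * W) i j := by
  set Cc := C.map Complex.ofReal
  set Wc := W.map Complex.ofReal
  set g : Matrix ι ι ℂ →ₗ[ℂ] ℂ :=
    { toFun := fun X => (Cc * X * Wc) i j
      map_add' := by intro X Y; simp [Matrix.mul_add, Matrix.add_mul]
      map_smul' := by intro c X; simp } with hg
  set gc : Matrix ι ι ℂ →L[ℂ] ℂ := LinearMap.toContinuousLinearMap g with hgc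
  have hgc_apply : ∀ X, gc X = (Cc * X * Wc) i j := fun X => rfl
  obtain ⟨G, hG0, hG⟩ : ∃ G : ℝ, 0 < G ∧ ∀ X, ‖gc X‖ ≤ G * ‖X‖ := gc.bound
  obtain ⟨K, hK⟩ := hM.exists_norm_resolventMatrix_le
  -- The resolvent decays only like `1 / s`. Subtracting its leading term, with the pole moved to
  -- `-1`, leaves a function of order `‖s‖⁻²` whose integral vanishes. The subtracted term has real
  -- part proportional to `1 / (1 + ω²)`, the source of `π`.
  set f : ℂ → ℂ := fun s => gc (resolventMatrix M s) - gc 1 * (s + 1)⁻¹ with hf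
  have hs1 : ∀ s : ℂ, 0 ≤ s.re → s + 1 ≠ 0 := by
    intro s hs h
    have := congrArg Complex.re h
    simp at this
    linarith
  have hdiff : ∀ s : ℂ, 0 ≤ s.re → DifferentiableAt ℂ f s := by
    intro s hs
    have h1 : DifferentiableAt ℂ (fun s => gc (resolventMatrix M s)) s :=
      gc.differentiableAt.comp s (hM.differentiableAt_resolventMatrix hs)
    refine h1.sub (DifferentiableAt.const_mul ?_ _)
    exact DifferentiableAt.inv (by fun_prop) (hs1 s hs)
  have hnorm1 : ∀ s : ℂ, 0 ≤ s.re → (1 + ‖s‖ ^ 2) ≤ ‖s + 1‖ ^ 2 := by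
    intro s hs
    rw [← Complex.normSq_eq_norm_sq, ← Complex.normSq_eq_norm_sq, Complex.normSq_apply,
      Complex.normSq_apply]
    simp
    nlinarith
  have hbound : ∀ s : ℂ, 0 ≤ s.re →
      ‖f s‖ ≤ G * ‖(1 : Matrix ι ι ℂ) + M.map Complex.ofReal‖ * K * 2 / (1 + ‖s‖ ^ 2) := by
    intro s hs
    have h1 : f s = gc (resolventMatrix M s * (1 + M.map Complex.ofReal)) * (s + 1)⁻¹ := by
      have h2 : resolventMatrix M s * (1 + M.map Complex.ofReal)
          = (s + 1) • resolventMatrix M s - 1 := by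
        have h3 := hM.resolventMatrix_mul hs
        rw [mul_sub, mul_smul_comm, mul_one, sub_eq_iff_eq_add] at h3
        rw [mul_add, mul_one, add_smul, one_smul, h3]
        abel
      rw [h2, map_sub, map_smul, smul_eq_mul, hf]
      field_simp [hs1 s hs]
    have h4 := hnorm1 s hs
    have hpos : 0 < 1 + ‖s‖ ^ 2 := by positivity
    have h5 : ‖s + 1‖⁻¹ * (1 + ‖s‖ ^ 2) ≤ 2 * (1 + ‖s‖) := by
      have h6 : 0 < ‖s + 1‖ := norm_pos_iff.2 (hs1 s hs)
      rw [inv_mul_le_iff₀ h6]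
      have h7 : ‖s + 1‖ * (2 * (1 + ‖s‖)) ≥ ‖s+1‖ * ‖s+1‖ := by
        gcongr
        have := norm_add_le s 1
        rw [norm_one] at this
        linarith [norm_nonneg s]
      nlinarith
    rw [h1, norm_mul, norm_inv, le_div_iff₀ hpos]
    have h8 : ‖gc (resolventMatrix M s * (1 + M.map Complex.ofReal))‖
        ≤ G * (‖resolventMatrix M s‖ * ‖(1 : Matrix ι ι ℂ) + M.map Complex.ofReal‖) :=
      (hG _).trans (by gcongr; exact norm_mul_le _ _)
    calc _ = ‖gc (resolventMatrix M s * (1 + M.map Complex.ofReal))‖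
          * (‖s + 1‖⁻¹ * (1 + ‖s‖ ^ 2)) := by ring
      _ ≤ G * (‖resolventMatrix M s‖ * ‖(1 : Matrix ι ι ℂ) + M.map Complex.ofReal‖)
          * (2 * (1 + ‖s‖)) := by gcongr
      _ = G * ‖(1 : Matrix ι ι ℂ) + M.map Complex.ofReal‖
          * (‖resolventMatrix M s‖ * (1 + ‖s‖)) * 2 := by ring
      _ ≤ _ := by gcongr; exact hK s hs
  obtain ⟨hint, hzero⟩ := integral_imaginary_axis_eq_zero hdiff hbound
  have hgc1 : gc 1 = (((C * W) i j : ℝ) : ℂ) := by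
    rw [hgc_apply, Matrix.mul_one]
    simp [Cc, Wc, Matrix.mul_apply]
  have heq : (fun ω : ℝ => ((Cc * resolventMatrix M (Complex.I * ω) * Wc) i j).re)
      = fun ω : ℝ => (f (Complex.I * ω)).re + (C * W) i j * (1 + ω ^ 2)⁻¹ := by
    funext ω
    have h1 : ((Complex.I * ω + 1)⁻¹ : ℂ).re = (1 + ω ^ 2)⁻¹ := by
      rw [Complex.inv_re, Complex.normSq_apply]
      simp
      ring
    rw [hf]
    simp only [hgc1, Complex.sub_re, Complex.re_ofReal_mul, h1, sub_add_cancel]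
    rfl
  rw [heq]
  have hre : Integrable fun ω : ℝ => (f (Complex.I * ω)).re := hint.re
  have hre0 : ∫ ω : ℝ, (f (Complex.I * ω)).re = 0 := by
    have := integral_re hint
    simp only [RCLike.re_eq_complex_re] at this
    rw [this, hzero, Complex.zero_re]
  refine ⟨hre.add (integrable_inv_one_add_sq.const_mul _), ?_⟩
  rw [integral_add hre (integrable_inv_one_add_sq.const_mul _), hre0, integral_const_mul,
    integral_univ_inv_one_add_sq, zero_add, mul_comm]

end Resolvent

end MIMOControl

/-! ### Lyapunov equations and channel powers -/

open Matrix MeasureTheory Filter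
namespace MIMOControl
variable {ι κ μ : Type*} [Fintype ι] [DecidableEq ι]

omit [DecidableEq ι] in
theorem map_ofReal_mul (A : Matrix κ ι ℝ) (B : Matrix ι μ ℝ) :
    (A * B).map Complex.ofReal = A.map Complex.ofReal * B.map Complex.ofReal :=
  Matrix.map_mul (f := Complex.ofRealHom)

theorem map_ofReal_add (A B : Matrix κ μ ℝ) :
    (A + B).map Complex.ofReal = A.map Complex.ofReal + B.map Complex.ofReal :=
  Matrix.map_add _ Complex.ofReal_add _ _

theorem conjTranspose_map_ofReal (A : Matrix κ μ ℝ) :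
    (A.map Complex.ofReal)ᴴ = Aᵀ.map Complex.ofReal := by
  ext i j; simp

/-- On the imaginary axis `star s = -s`, so the Lyapunov equation reads `Q = (s - M) X + X (s -
M)ᴴ`, and each factor cancels against one resolvent. -/
theorem IsHurwitz.resolventMatrix_mul_mul_conjTranspose {M : Matrix ι ι ℝ} (hM : IsHurwitz M)
    {X Q : Matrix ι ι ℝ} (h : M * X + X * Mᵀ + Q = 0) (ω : ℝ) :
    resolventMatrix M (Complex.I * ω) * Q.map Complex.ofReal
        * (resolventMatrix M (Complex.I * ω))ᴴ
      = resolventMatrix M (Complex.I * ω) * X.map Complex.ofReal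
        + X.map Complex.ofReal * (resolventMatrix M (Complex.I * ω))ᴴ := by
  have hs : 0 ≤ (Complex.I * ω).re := by simp
  set s := Complex.I * (ω : ℂ) with hs_def
  have hstar : star s = -s := by simp [hs_def]
  have h1 := hM.resolventMatrix_mul hs
  have h2 := congrArg Matrix.conjTranspose h1
  rw [Matrix.conjTranspose_mul, Matrix.conjTranspose_one] at h2
  have hQ : Q.map Complex.ofReal = (s • (1 : Matrix ι ι ℂ) - M.map Complex.ofReal)
      * X.map Complex.ofReal
      + X.map Complex.ofReal * (s • (1 : Matrix ι ι ℂ) - M.map Complex.ofReal)ᴴ := by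
    have h3 : Q = -(M * X) - X * Mᵀ := by rw [← sub_eq_zero, ← h]; abel
    rw [h3, Matrix.conjTranspose_sub, Matrix.conjTranspose_smul, Matrix.conjTranspose_one,
      conjTranspose_map_ofReal, hstar, Matrix.map_sub _ Complex.ofReal_sub,
      Matrix.map_neg _ Complex.ofReal_neg, map_ofReal_mul, map_ofReal_mul, sub_mul, mul_sub,
      smul_mul_assoc, mul_smul_comm, one_mul, mul_one, neg_smul]
    abel
  rw [hQ, mul_add, add_mul, ← mul_assoc, h1, one_mul, mul_assoc, mul_assoc, h2, mul_one, add_comm]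

/-- The frequency domain integral of a filtered white noise, in terms of the solution of the
Lyapunov equation. -/
theorem IsHurwitz.integral_lyapunov {M : Matrix ι ι ℝ} (hM : IsHurwitz M)
    {X Q : Matrix ι ι ℝ} (h : M * X + X * Mᵀ + Q = 0) (C : Matrix κ ι ℝ) (i j : κ) :
    ∫ ω : ℝ, ((C.map Complex.ofReal * (resolventMatrix M (Complex.I * ω) * Q.map Complex.ofReal
        * (resolventMatrix M (Complex.I * ω))ᴴ) * (C.map Complex.ofReal)ᴴ) i j).re
      = 2 * Real.pi * (C * X * Cᵀ) i j := by
  obtain ⟨hi1, he1⟩ := hM.integral_re_resolventMatrix C (X * Cᵀ) i j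
  obtain ⟨hi2, he2⟩ := hM.integral_re_resolventMatrix C (Xᵀ * Cᵀ) j i
  have heq : ∀ ω : ℝ, ((C.map Complex.ofReal * (resolventMatrix M (Complex.I * ω)
        * Q.map Complex.ofReal
        * (resolventMatrix M (Complex.I * ω))ᴴ) * (C.map Complex.ofReal)ᴴ) i j).re
      = ((C.map Complex.ofReal * resolventMatrix M (Complex.I * ω)
          * (X * Cᵀ).map Complex.ofReal) i j).re
        + ((C.map Complex.ofReal * resolventMatrix M (Complex.I * ω)
          * (Xᵀ * Cᵀ).map Complex.ofReal) j i).re := by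
    intro ω
    have h1 : ((C.map Complex.ofReal * resolventMatrix M (Complex.I * ω)
          * (Xᵀ * Cᵀ).map Complex.ofReal) j i).re
        = ((C.map Complex.ofReal * resolventMatrix M (Complex.I * ω)
          * (Xᵀ * Cᵀ).map Complex.ofReal)ᴴ i j).re := by
      rw [Matrix.conjTranspose_apply]; simp
    rw [h1, hM.resolventMatrix_mul_mul_conjTranspose h, ← Complex.add_re, ← Matrix.add_apply]
    congr 2
    simp only [Matrix.conjTranspose_mul, conjTranspose_map_ofReal, map_ofReal_mul,
      Matrix.transpose_transpose, Matrix.mul_add, Matrix.add_mul,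
      Matrix.mul_assoc]
  simp_rw [heq]
  rw [integral_add hi1 hi2, he1, he2, ← Matrix.mul_assoc, ← Matrix.mul_assoc]
  have : (C * Xᵀ * Cᵀ) j i = (C * X * Cᵀ) i j := by
    rw [← Matrix.transpose_apply (C * Xᵀ * Cᵀ), Matrix.transpose_mul, Matrix.transpose_mul,
      Matrix.transpose_transpose, Matrix.transpose_transpose, Matrix.mul_assoc]
  rw [this]; ring

/-- With `Q = 0` and `C = 1` the integral formula reads `0 = 2π X i j`. -/
theorem IsHurwitz.eq_zero_of_lyapunov {M : Matrix ι ι ℝ} (hM : IsHurwitz M)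
    {X : Matrix ι ι ℝ} (h : M * X + X * Mᵀ = 0) : X = 0 := by
  ext i j
  have := hM.integral_lyapunov (Q := 0) (by rw [h, add_zero]) 1 i j
  simpa [Real.pi_ne_zero] using this

/-- Uniqueness gives existence, since an injective endomorphism of a finite-dimensional space is
surjective. -/
theorem IsHurwitz.exists_lyapunov {M : Matrix ι ι ℝ} (hM : IsHurwitz M) (Q : Matrix ι ι ℝ) :
    ∃ X : Matrix ι ι ℝ, M * X + X * Mᵀ + Q = 0 := by
  let f : Matrix ι ι ℝ →ₗ[ℝ] Matrix ι ι ℝ :=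
    { toFun := fun X => M * X + X * Mᵀ
      map_add' := by intro X Y; rw [mul_add, add_mul]; abel
      map_smul' := by intro c X; simp }
  have hf : Function.Injective f := by
    rw [injective_iff_map_eq_zero]
    exact fun X hX => hM.eq_zero_of_lyapunov hX
  obtain ⟨X, hX⟩ := LinearMap.injective_iff_surjective.1 hf (-Q)
  exact ⟨X, by rw [← sub_eq_zero, sub_neg_eq_add] at hX; exact hX⟩

open scoped ComplexOrder in
omit [DecidableEq ι] in
theorem posSemidef_map_ofReal {Q : Matrix ι ι ℝ} (hQ : Q.PosSemidef) :
    (Q.map Complex.ofReal).PosSemidef := by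
  obtain ⟨m, v, hv⟩ := Matrix.posSemidef_iff_eq_sum_vecMulVec.1 hQ
  refine Matrix.posSemidef_iff_eq_sum_vecMulVec.2 ⟨m, fun i j => (v i j : ℂ), ?_⟩
  rw [hv]
  ext i j
  simp [Matrix.sum_apply, Matrix.vecMulVec_apply]

open scoped ComplexOrder in
-- Symmetry comes from uniqueness, as `Xᵀ` solves the same equation. Up to the factor `2π`, the
-- quadratic form of `X` at `x` is the integral formula with `C` the row `x`, whose integrand is
-- nonnegative.
theorem IsHurwitz.posSemidef_of_lyapunov {M : Matrix ι ι ℝ} (hM : IsHurwitz M)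
    {X Q : Matrix ι ι ℝ} (hQ : Q.PosSemidef) (h : M * X + X * Mᵀ + Q = 0) : X.PosSemidef := by
  have hQs : Qᵀ = Q := by
    have := hQ.isHermitian.eq
    rwa [Matrix.conjTranspose_eq_transpose_of_trivial] at this
  have hsymm : Xᵀ = X := by
    have h2 := congrArg Matrix.transpose h
    simp only [Matrix.transpose_add, Matrix.transpose_mul, Matrix.transpose_transpose, hQs,
      Matrix.transpose_zero] at h2
    have h3 : M * (Xᵀ - X) + (Xᵀ - X) * Mᵀ = 0 := by
      rw [mul_sub, sub_mul]
      calc _ = (M * Xᵀ + Xᵀ * Mᵀ) - (M * X + X * Mᵀ) := by abel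
        _ = -Q - -Q := by
            congr 1
            · rw [eq_neg_iff_add_eq_zero, ← h2]; abel
            · rw [eq_neg_iff_add_eq_zero, ← h]
        _ = 0 := sub_self _
    exact sub_eq_zero.1 (hM.eq_zero_of_lyapunov h3)
  refine Matrix.PosSemidef.of_dotProduct_mulVec_nonneg ?_ fun x => ?_
  · rw [Matrix.IsHermitian, Matrix.conjTranspose_eq_transpose_of_trivial, hsymm]
  have h1 := hM.integral_lyapunov h (Matrix.replicateRow Unit x) () ()
  have h2 : (Matrix.replicateRow Unit x * X * (Matrix.replicateRow Unit x)ᵀ) () ()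
      = star x ⬝ᵥ X *ᵥ x := by
    rw [Matrix.mul_assoc]
    simp [Matrix.mul_apply, dotProduct, Matrix.mulVec]
  rw [h2] at h1
  have h3 : 0 ≤ 2 * Real.pi * (star x ⬝ᵥ X *ᵥ x) := by
    rw [← h1]
    refine integral_nonneg fun ω => ?_
    have h4 := posSemidef_map_ofReal hQ
    have h5 := ((h4.mul_mul_conjTranspose_same (resolventMatrix M (Complex.I * ω))
      ).mul_mul_conjTranspose_same ((Matrix.replicateRow Unit x).map Complex.ofReal)).diag_nonneg
        (i := ())
    exact (Complex.le_def.1 h5).1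
  exact nonneg_of_mul_nonneg_right h3 (by positivity)

theorem inputPower_eq {n m l : ℕ} {A : Matrix (Fin n) (Fin n) ℝ} {B : Matrix (Fin n) (Fin m) ℝ}
    {F : Matrix (Fin m) (Fin n) ℝ} {T : Matrix (Fin l) (Fin m) ℝ} {R : Matrix (Fin m) (Fin l) ℝ}
    (hM : IsHurwitz (closedLoop A B F T R)) (N : Fin l → ℝ) {X : Matrix (Fin n) (Fin n) ℝ}
    (hX : closedLoop A B F T R * X + X * (closedLoop A B F T R)ᵀ
      + B * R * Matrix.diagonal N * (B * R)ᵀ = 0) (i : Fin l) :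
    inputPower A B F T R N i = (T * F * X * (T * F)ᵀ) i i := by
  have h := hM.integral_lyapunov hX (T * F) i i
  have heq : ∀ ω : ℝ, inputPSD A B F T R N ω
      = (T * F).map Complex.ofReal
        * (resolventMatrix (closedLoop A B F T R) (Complex.I * ω)
        * (B * R * Matrix.diagonal N * (B * R)ᵀ).map Complex.ofReal
        * (resolventMatrix (closedLoop A B F T R) (Complex.I * ω))ᴴ)
        * ((T * F).map Complex.ofReal)ᴴ := by
    intro ω
    rw [inputPSD, transferFunction]
    have hd : (Matrix.diagonal N).map Complex.ofReal = Matrix.diagonal fun i => (N i : ℂ) := by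
      rw [Matrix.diagonal_map Complex.ofReal_zero]
    rw [map_ofReal_mul (B * R * _), map_ofReal_mul (B * R) (diagonal N), hd, ← conjTranspose_map_ofReal]
    simp only [resolventMatrix, Matrix.conjTranspose_mul, Matrix.mul_assoc]
  rw [inputPower]
  simp_rw [heq]
  rw [h]
  field_simp


/-! ### Real spectral splitting -/

open Matrix Polynomial

section PolynomialFactor

/-- Both roots have the same minimal polynomial over `ℝ`, and it divides `(X - z)(X - z̄)`, which is
real. -/
theorem _root_.Irreducible.aeval_complex_eq_or_conj {p : ℝ[X]} (hp : Irreducible p) {z w : ℂ}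
    (hz : aeval z p = 0) (hw : aeval w p = 0) : w = z ∨ w = (starRingEnd ℂ) z := by
  have h1 := minpoly.eq_of_irreducible hp hz
  have h2 := minpoly.eq_of_irreducible hp hw
  have h3 : minpoly ℝ w = minpoly ℝ z := h2.symm.trans h1
  have hq : minpoly ℝ z ∣ X ^ 2 - C (2 * z.re) * X + C (z.re ^ 2 + z.im ^ 2) := by
    refine minpoly.dvd ℝ z ?_
    simp only [map_add, map_sub, map_pow, map_mul, aeval_X, aeval_C]
    apply Complex.ext <;> simp [pow_two] <;> ring
  obtain ⟨c, hc⟩ := hq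
  have hw0 : aeval w (X ^ 2 - C (2 * z.re) * X + C (z.re ^ 2 + z.im ^ 2) : ℝ[X]) = 0 := by
    rw [hc, ← h3, map_mul, minpoly.aeval, zero_mul]
  have hfac : (w - z) * (w - (starRingEnd ℂ) z) = 0 := by
    rw [← hw0]
    simp only [map_add, map_sub, map_pow, map_mul, aeval_X, aeval_C]
    apply Complex.ext <;> simp [pow_two] <;> ring
  rcases mul_eq_zero.1 hfac with h | h
  · exact Or.inl (sub_eq_zero.1 h)
  · exact Or.inr (sub_eq_zero.1 h)

/-- A real polynomial splits into a factor all of whose roots satisfy `P` and a factor none of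
whose roots do, for every property `P` of complex numbers that is invariant under conjugation. -/
theorem exists_mul_eq_of_conj_invariant {P : ℂ → Prop} (hP : ∀ z, P z → P ((starRingEnd ℂ) z))
    (q : ℝ[X]) (hq : q ≠ 0) :
    ∃ a b : ℝ[X], a * b = q ∧ (∀ z : ℂ, aeval z a = 0 → P z) ∧
      (∀ z : ℂ, aeval z b = 0 → ¬ P z) := by
  induction q using WfDvdMonoid.induction_on_irreducible with
  | zero => exact absurd rfl hq
  | unit u hu =>
    refine ⟨u, 1, mul_one u, fun z hz => ?_, fun z hz => ?_⟩
    · exact absurd hz (hu.map (aeval z)).ne_zero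
    · simp at hz
  | mul q i hq0 hi ih =>
    obtain ⟨a, b, hab, ha, hb⟩ := ih hq0
    -- The roots of an irreducible factor are conjugate to each other, so `P` holds at all of them
    -- or at none, and the factor goes to one side whole.
    by_cases h : ∃ z : ℂ, aeval z i = 0 ∧ P z
    · obtain ⟨z, hz, hPz⟩ := h
      refine ⟨i * a, b, by rw [mul_assoc, hab], fun w hw => ?_, hb⟩
      rw [map_mul, mul_eq_zero] at hw
      rcases hw with hw | hw
      · rcases hi.aeval_complex_eq_or_conj hz hw with rfl | rfl
        · exact hPz
        · exact hP z hPz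
      · exact ha w hw
    · push Not at h
      refine ⟨a, i * b, by rw [← hab]; ring, ha, fun w hw => ?_⟩
      rw [map_mul, mul_eq_zero] at hw
      rcases hw with hw | hw
      · exact h w hw
      · exact hb w hw

end PolynomialFactor

section SpectralQuotient

variable {ι κ : Type*} [Fintype ι] [DecidableEq ι] [Fintype κ] [DecidableEq κ]

theorem mul_aeval_eq_aeval_mul {L : Matrix κ ι ℝ} {M : Matrix ι ι ℝ} {U : Matrix κ κ ℝ}
    (h : L * M = U * L) (p : ℝ[X]) : L * aeval M p = aeval U p * L := by
  induction p using Polynomial.induction_on' with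
  | add p q hp hq => simp only [map_add, Matrix.mul_add, Matrix.add_mul, hp, hq]
  | monomial k a =>
    have hk : L * M ^ k = U ^ k * L := by
      induction k with
      | zero => simp
      | succ k ih =>
        rw [pow_succ, pow_succ, ← Matrix.mul_assoc, ih, Matrix.mul_assoc, h, Matrix.mul_assoc]
    simp only [aeval_monomial, ← Algebra.smul_def, Matrix.mul_smul, Matrix.smul_mul, hk]

theorem map_aeval_mulVec {M : Matrix ι ι ℝ} {z : ℂ} {v : ι → ℂ}
    (hv : M.map Complex.ofReal *ᵥ v = z • v) (p : ℝ[X]) :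
    (aeval M p).map Complex.ofReal *ᵥ v = aeval z p • v := by
  induction p using Polynomial.induction_on' with
  | add p q hp hq => rw [map_add, map_ofReal_add, Matrix.add_mulVec, hp, hq, map_add, add_smul]
  | monomial k a =>
    have hk : (M ^ k).map Complex.ofReal *ᵥ v = z ^ k • v := by
      induction k with
      | zero => simp
      | succ k ih =>
        rw [pow_succ, map_ofReal_mul, ← Matrix.mulVec_mulVec, hv, Matrix.mulVec_smul, ih,
          smul_smul, pow_succ, mul_comm]
    have h1 : (a • M ^ k).map Complex.ofReal = (a : ℂ) • (M ^ k).map Complex.ofReal := by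
      ext i j; simp
    rw [aeval_monomial, aeval_monomial, ← Algebra.smul_def, h1, Matrix.smul_mulVec, hk, smul_smul]
    rfl

theorem aeval_eq_zero_of_mem_eigenvalues {M : Matrix ι ι ℝ} {z : ℂ} (hz : z ∈ eigenvalues M)
    {p : ℝ[X]} (hp : aeval M p = 0) : aeval z p = 0 := by
  obtain ⟨v, hv0, hv⟩ := (mem_eigenvalues_iff_mulVec M z).1 hz
  have h := map_aeval_mulVec hv p
  rw [hp, Matrix.map_zero _ Complex.ofReal_zero, Matrix.zero_mulVec] at h
  exact (smul_eq_zero.1 h.symm).resolve_right hv0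

theorem eigenvalues_eq_roots_map (M : Matrix ι ι ℝ) :
    eigenvalues M = (M.charpoly.map Complex.ofRealHom).roots := by
  rw [← Matrix.charpoly_map]; rfl

theorem mem_eigenvalues_iff_aeval_charpoly (M : Matrix ι ι ℝ) (z : ℂ) :
    z ∈ eigenvalues M ↔ aeval z M.charpoly = 0 := by
  rw [eigenvalues_eq_roots_map,
    mem_roots ((Polynomial.map_ne_zero_iff Complex.ofRealHom.injective).2 M.charpoly_monic.ne_zero),
    IsRoot, eval_map, aeval_def]
  rfl

theorem mem_eigenvalues_iff_aeval_minpoly (M : Matrix ι ι ℝ) (z : ℂ) :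
    z ∈ eigenvalues M ↔ aeval z (minpoly ℝ M) = 0 := by
  refine ⟨fun h => aeval_eq_zero_of_mem_eigenvalues h (minpoly.aeval ℝ M), fun h => ?_⟩
  rw [mem_eigenvalues_iff_aeval_charpoly]
  obtain ⟨c, hc⟩ := Matrix.minpoly_dvd_charpoly M
  rw [hc, map_mul, h, zero_mul]

/-- The quotient of a real matrix onto its spectral part given by `P`, for every property `P` of
complex numbers that is invariant under conjugation. -/
theorem exists_spectral_quotient (M : Matrix ι ι ℝ) (P : ℂ → Prop) [DecidablePred P]
    (hP : ∀ z, P z → P ((starRingEnd ℂ) z)) :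
    ∃ (p : ℕ) (L : Matrix (Fin p) ι ℝ) (J : Matrix ι (Fin p) ℝ) (U : Matrix (Fin p) (Fin p) ℝ),
      L * J = 1 ∧ L * M = U * L ∧ eigenvalues U = (eigenvalues M).filter P ∧
      ∀ (z : ℂ) (v : ι → ℂ), v ≠ 0 → M.map Complex.ofReal *ᵥ v = z • v →
        L.map Complex.ofReal *ᵥ v = 0 → ¬ P z := by
  obtain ⟨a, b, hab, ha, hb⟩ := exists_mul_eq_of_conj_invariant hP M.charpoly
    M.charpoly_monic.ne_zero
  have hcop : IsCoprime a b := by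
    rw [Polynomial.isCoprime_iff_aeval_ne_zero_of_isAlgClosed ℝ ℂ]
    intro z
    by_contra! h
    exact hb z h.2 (ha z h.1)
  set f : (ι → ℝ) →ₗ[ℝ] (ι → ℝ) := Matrix.toLin' M with hf
  have haeval : ∀ p : ℝ[X], aeval f p = Matrix.toLin' (aeval M p) := fun p =>
    Polynomial.aeval_algHom_apply (Matrix.toLinAlgEquiv' (R := ℝ) (n := ι)) M p
  set V := LinearMap.ker (aeval f a)
  set W := LinearMap.ker (aeval f b)
  have hVW : IsCompl V W := by
    refine ⟨disjoint_ker_aeval_of_isCoprime f hcop, codisjoint_iff.2 ?_⟩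
    rw [sup_ker_aeval_eq_ker_aeval_mul_of_coprime f hcop, hab, haeval, Matrix.aeval_self_charpoly,
      map_zero, LinearMap.ker_zero]
  have hcomm : ∀ (p : ℝ[X]) (x : ι → ℝ), aeval f p (f x) = f (aeval f p x) := fun p x => by
    have : aeval f p * f = f * aeval f p := by
      have h1 : aeval f (p * X) = aeval f (X * p) := by rw [mul_comm]
      simpa using h1
    exact LinearMap.congr_fun this x
  have hfV : ∀ x ∈ V, f x ∈ V := fun x hx => by
    rw [LinearMap.mem_ker] at hx ⊢
    rw [hcomm, hx, map_zero]
  have hfW : ∀ x ∈ W, f x ∈ W := fun x hx => by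
    rw [LinearMap.mem_ker] at hx ⊢
    rw [hcomm, hx, map_zero]
  let fV := f.restrict hfV
  let fW := f.restrict hfW
  let e := Submodule.prodEquivOfIsCompl V W hVW
  let bV := Module.finBasis ℝ V
  let bW := Module.finBasis ℝ W
  let b0 := Pi.basisFun ℝ ι
  have he : ∀ x, f (e x) = e (fV.prodMap fW x) := by
    rintro ⟨x, y⟩
    simp [e, fV, fW]
  have hψ : fV.prodMap fW = e.symm.conj f := by
    refine LinearMap.ext fun x => ?_
    rw [LinearEquiv.conj_apply_apply, LinearEquiv.symm_symm, he, LinearEquiv.symm_apply_apply]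
  have hchar : M.charpoly = fV.charpoly * fW.charpoly := by
    rw [← LinearMap.charpoly_prodMap, hψ, LinearEquiv.charpoly_conj, hf, Matrix.charpoly_toLin']
  let πV : (ι → ℝ) →ₗ[ℝ] V := LinearMap.fst ℝ V W ∘ₗ e.symm.toLinearMap
  let πW : (ι → ℝ) →ₗ[ℝ] W := LinearMap.snd ℝ V W ∘ₗ e.symm.toLinearMap
  have he' : ∀ x, e.symm (f x) = fV.prodMap fW (e.symm x) := fun x => by
    rw [LinearEquiv.symm_apply_eq, ← he, LinearEquiv.apply_symm_apply]
  have hπV : πV ∘ₗ f = fV ∘ₗ πV := by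
    refine LinearMap.ext fun x => ?_
    simp only [πV, LinearMap.comp_apply, LinearEquiv.coe_coe, he']
    rfl
  have hπW : πW ∘ₗ f = fW ∘ₗ πW := by
    refine LinearMap.ext fun x => ?_
    simp only [πW, LinearMap.comp_apply, LinearEquiv.coe_coe, he']
    rfl
  have hιV : πV ∘ₗ V.subtype = LinearMap.id := by
    refine LinearMap.ext fun x => ?_
    have : e.symm (x : ι → ℝ) = (x, 0) := by
      rw [LinearEquiv.symm_apply_eq]; simp [e]
    simp [πV, this]
  have hιW : πW ∘ₗ W.subtype = LinearMap.id := by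
    refine LinearMap.ext fun x => ?_
    have : e.symm (x : ι → ℝ) = (0, x) := by
      rw [LinearEquiv.symm_apply_eq]; simp [e]
    simp [πW, this]
  have hsum : V.subtype ∘ₗ πV + W.subtype ∘ₗ πW = LinearMap.id := by
    refine LinearMap.ext fun x => ?_
    have : e (e.symm x) = ((e.symm x).1 : ι → ℝ) + (e.symm x).2 := by simp [e]
    rw [LinearEquiv.apply_symm_apply] at this
    exact this.symm
  set LV := LinearMap.toMatrix b0 bV πV
  set LW := LinearMap.toMatrix b0 bW πW
  set JV := LinearMap.toMatrix bV b0 V.subtype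
  set JW := LinearMap.toMatrix bW b0 W.subtype
  set U := LinearMap.toMatrix bV bV fV
  set U' := LinearMap.toMatrix bW bW fW
  have hM : LinearMap.toMatrix b0 b0 f = M := by
    rw [LinearMap.toMatrix_eq_toMatrix', hf, LinearMap.toMatrix'_toLin']
  have hpM : ∀ p : ℝ[X], LinearMap.toMatrix b0 b0 (aeval f p) = aeval M p := fun p => by
    rw [LinearMap.toMatrix_eq_toMatrix', haeval, LinearMap.toMatrix'_toLin']
  have e1 : LV * JV = 1 := by
    rw [← LinearMap.toMatrix_comp, hιV, LinearMap.toMatrix_id]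
  have e1' : LW * JW = 1 := by
    rw [← LinearMap.toMatrix_comp, hιW, LinearMap.toMatrix_id]
  have e2 : LV * M = U * LV := by
    rw [← hM, ← LinearMap.toMatrix_comp, hπV, LinearMap.toMatrix_comp _ bV]
  have e2' : LW * M = U' * LW := by
    rw [← hM, ← LinearMap.toMatrix_comp, hπW, LinearMap.toMatrix_comp _ bW]
  have e3 : JV * LV + JW * LW = 1 := by
    rw [← LinearMap.toMatrix_comp, ← LinearMap.toMatrix_comp, ← map_add, hsum,
      LinearMap.toMatrix_id]
  have e4 : aeval M a * JV = 0 := by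
    rw [← hpM, ← LinearMap.toMatrix_comp]
    have : aeval f a ∘ₗ V.subtype = 0 := by
      refine LinearMap.ext fun x => ?_
      exact x.2
    rw [this, map_zero]
  have e4' : aeval M b * JW = 0 := by
    rw [← hpM, ← LinearMap.toMatrix_comp]
    have : aeval f b ∘ₗ W.subtype = 0 := by
      refine LinearMap.ext fun x => ?_
      exact x.2
    rw [this, map_zero]
  -- Since `a` annihilates `U` and `b` annihilates `U'`, `P` holds at every eigenvalue of `U` and at
  -- none of `U'`.
  have e5 : aeval U a = 0 := by
    have := mul_aeval_eq_aeval_mul e2 a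
    rw [← Matrix.mul_one (aeval U a), ← e1, ← Matrix.mul_assoc, ← this, Matrix.mul_assoc, e4,
      Matrix.mul_zero]
  have e5' : aeval U' b = 0 := by
    have := mul_aeval_eq_aeval_mul e2' b
    rw [← Matrix.mul_one (aeval U' b), ← e1', ← Matrix.mul_assoc, ← this, Matrix.mul_assoc, e4',
      Matrix.mul_zero]
  have hcU : U.charpoly = fV.charpoly := LinearMap.charpoly_toMatrix fV bV
  have hcU' : U'.charpoly = fW.charpoly := LinearMap.charpoly_toMatrix fW bW
  have hroots : eigenvalues M = eigenvalues U + eigenvalues U' := by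
    rw [eigenvalues_eq_roots_map, eigenvalues_eq_roots_map, eigenvalues_eq_roots_map, hchar,
      Polynomial.map_mul, roots_mul, hcU, hcU']
    rw [← Polynomial.map_mul, ← hchar]
    exact (Polynomial.map_ne_zero_iff Complex.ofRealHom.injective).2 M.charpoly_monic.ne_zero
  refine ⟨_, LV, JV, U, e1, e2, ?_, ?_⟩
  · rw [hroots, Multiset.filter_add, Multiset.filter_eq_self.2, Multiset.filter_eq_nil.2, add_zero]
    · exact fun z hz => hb z (aeval_eq_zero_of_mem_eigenvalues hz e5')
    · exact fun z hz => ha z (aeval_eq_zero_of_mem_eigenvalues hz e5)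
  · intro z v hv0 hv hLv
    refine hb z ?_
    -- `b(M)` vanishes on `W`, hence factors through `LV`; an eigenvector killed by `LV` therefore
    -- has an eigenvalue that is a root of `b`.
    have h1 : aeval M b = aeval M b * JV * LV := by
      rw [← add_zero (aeval M b * JV * LV), ← Matrix.zero_mul LW, ← e4', Matrix.mul_assoc,
        Matrix.mul_assoc, ← Matrix.mul_add, e3, Matrix.mul_one]
    have h2 := map_aeval_mulVec hv b
    rw [h1, map_ofReal_mul, ← Matrix.mulVec_mulVec, hLv, Matrix.mulVec_zero] at h2
    exact (smul_eq_zero.1 h2.symm).resolve_right hv0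

end SpectralQuotient


/-! ### Gramians and the lower bound on the power -/

open Matrix

section Gramian

variable {ι κ μ ν : Type*} [Fintype ι] [Fintype κ] [DecidableEq κ] [Fintype μ] [Fintype ν]

theorem map_ofReal_mulVec_eq_zero_iff {α : Type*} (Y : Matrix α ι ℝ) (w : ι → ℂ) :
    Y.map Complex.ofReal *ᵥ w = 0 ↔
      (Y *ᵥ fun i => (w i).re) = 0 ∧ (Y *ᵥ fun i => (w i).im) = 0 := by
  simp only [funext_iff, ← forall_and]
  refine forall_congr' fun i => ?_
  rw [Complex.ext_iff]
  simp [Matrix.mulVec, dotProduct]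

theorem vecMul_map_ofReal_transpose {α : Type*} (Y : Matrix α ι ℝ) (w : ι → ℂ) :
    w ᵥ* Yᵀ.map Complex.ofReal = Y.map Complex.ofReal *ᵥ w := by
  rw [Matrix.transpose_map, Matrix.vecMul_transpose]

/-- The complexified kernel of `Y` is nonzero and `Uᵀ`-invariant, so it contains an eigenvector.
This turns a singular Gramian into a violation of the PBH test. -/
theorem exists_eigenvector_of_invariant_ker {Y U : Matrix κ κ ℝ} (hY : Y.det = 0)
    (hinv : ∀ v, Y *ᵥ v = 0 → Y *ᵥ (Uᵀ *ᵥ v) = 0) :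
    ∃ (z : ℂ) (w : κ → ℂ), w ≠ 0 ∧ w ᵥ* U.map Complex.ofReal = z • w ∧
      Y.map Complex.ofReal *ᵥ w = 0 := by
  set K := LinearMap.ker (Matrix.toLin' (Y.map Complex.ofReal)) with hK
  set f := Matrix.toLin' (Uᵀ.map Complex.ofReal) with hf
  have hfK : ∀ w ∈ K, f w ∈ K := by
    intro w hw
    rw [hK, LinearMap.mem_ker, Matrix.toLin'_apply, map_ofReal_mulVec_eq_zero_iff] at hw
    rw [hK, LinearMap.mem_ker, hf, Matrix.toLin'_apply, Matrix.toLin'_apply, Matrix.mulVec_mulVec,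
      ← map_ofReal_mul, map_ofReal_mulVec_eq_zero_iff, ← Matrix.mulVec_mulVec,
      ← Matrix.mulVec_mulVec]
    exact ⟨hinv _ hw.1, hinv _ hw.2⟩
  have hnt : Nontrivial K := by
    have hdet : (Y.map Complex.ofReal).det = 0 := by
      have := RingHom.map_det Complex.ofRealHom Y
      rw [hY, map_zero] at this
      exact this.symm
    obtain ⟨v, hv0, hv⟩ := Matrix.exists_mulVec_eq_zero_iff.2 hdet
    exact ⟨⟨⟨v, hv⟩, 0, fun h => hv0 (congrArg Subtype.val h)⟩⟩
  obtain ⟨z, hz⟩ := Module.End.exists_eigenvalue (f.restrict hfK)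
  obtain ⟨w, hw⟩ := hz.exists_hasEigenvector
  refine ⟨z, w, fun h => hw.2 (Subtype.ext h), ?_, w.2⟩
  have h1 := congrArg Subtype.val hw.apply_eq_smul
  have h2 : Uᵀ.map Complex.ofReal *ᵥ (w : κ → ℂ) = z • (w : κ → ℂ) := h1
  rwa [← vecMul_map_ofReal_transpose, Matrix.transpose_transpose] at h2

/-- Pairing the equation with `x` on both sides leaves only `‖Vᵀ x‖² = 0`; applying it to `x` then
leaves `X Mᵀ x = 0`. -/
theorem ker_invariant_of_lyapunov {M X : Matrix ι ι ℝ} {V : Matrix ι μ ℝ} (hX : X.PosSemidef)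
    (h : M * X + X * Mᵀ + V * Vᵀ = 0) {x : ι → ℝ} (hx : X *ᵥ x = 0) :
    Vᵀ *ᵥ x = 0 ∧ X *ᵥ (Mᵀ *ᵥ x) = 0 := by
  have hXt : Xᵀ = X := by
    have := hX.isHermitian.eq
    rwa [Matrix.conjTranspose_eq_transpose_of_trivial] at this
  have h1 : X *ᵥ (Mᵀ *ᵥ x) + V *ᵥ (Vᵀ *ᵥ x) = 0 := by
    have := congrArg (· *ᵥ x) h
    simpa only [Matrix.add_mulVec, ← Matrix.mulVec_mulVec, hx, Matrix.mulVec_zero, zero_add,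
      Matrix.zero_mulVec] using this
  have h2 : x ⬝ᵥ (X *ᵥ (Mᵀ *ᵥ x)) = 0 := by
    rw [Matrix.dotProduct_mulVec, ← Matrix.mulVec_transpose, hXt, hx, zero_dotProduct]
  have h3 : Vᵀ *ᵥ x = 0 := by
    have := congrArg (x ⬝ᵥ ·) h1
    simp only [dotProduct_add, h2, zero_add, dotProduct_zero] at this
    rw [Matrix.dotProduct_mulVec, ← Matrix.mulVec_transpose] at this
    exact dotProduct_self_eq_zero.1 this
  refine ⟨h3, ?_⟩
  rwa [h3, Matrix.mulVec_zero, add_zero] at h1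

/-- If the compression were singular, its kernel would be `Uᵀ`-invariant and contain a left
eigenvector of `U` annihilating `L V`. The intertwining `hL` is asked only where `Vᵀ Lᵀ v = 0`:
there `Bᵀ` vanishes too, so the closed loop acts like the open loop. -/
theorem posDef_of_lyapunov {M X : Matrix ι ι ℝ} {V : Matrix ι μ ℝ} (hX : X.PosSemidef)
    (h : M * X + X * Mᵀ + V * Vᵀ = 0) (L : Matrix κ ι ℝ) (U : Matrix κ κ ℝ)
    (hL : ∀ v, Vᵀ *ᵥ (Lᵀ *ᵥ v) = 0 → Mᵀ *ᵥ (Lᵀ *ᵥ v) = Lᵀ *ᵥ (Uᵀ *ᵥ v))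
    (hobs : ∀ (z : ℂ) (w : κ → ℂ), w ≠ 0 → w ᵥ* U.map Complex.ofReal = z • w →
      w ᵥ* (L * V).map Complex.ofReal ≠ 0) :
    (L * X * Lᵀ).PosDef := by
  have hpsd : (L * X * Lᵀ).PosSemidef := by
    have := hX.mul_mul_conjTranspose_same L
    rwa [Matrix.conjTranspose_eq_transpose_of_trivial] at this
  have hker : ∀ v, (L * X * Lᵀ) *ᵥ v = 0 → X *ᵥ (Lᵀ *ᵥ v) = 0 := by
    intro v hv
    rw [← hX.dotProduct_mulVec_zero_iff]
    have := congrArg (v ⬝ᵥ ·) hv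
    simp only [dotProduct_zero] at this
    rw [star_trivial, ← this, ← Matrix.mulVec_mulVec, ← Matrix.mulVec_mulVec,
      Matrix.dotProduct_mulVec v L, Matrix.mulVec_transpose]
  rw [hpsd.posDef_iff_isUnit, Matrix.isUnit_iff_isUnit_det, isUnit_iff_ne_zero]
  intro hdet
  have hinv : ∀ v, (L * X * Lᵀ) *ᵥ v = 0 → (L * X * Lᵀ) *ᵥ (Uᵀ *ᵥ v) = 0 := by
    intro v hv
    obtain ⟨h1, h2⟩ := ker_invariant_of_lyapunov hX h (hker v hv)
    rw [hL v h1] at h2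
    rw [← Matrix.mulVec_mulVec, ← Matrix.mulVec_mulVec, h2, Matrix.mulVec_zero]
  obtain ⟨z, w, hw0, hw, hYw⟩ := exists_eigenvector_of_invariant_ker hdet hinv
  refine hobs z w hw0 hw ?_
  rw [← Matrix.transpose_transpose (L * V), vecMul_map_ofReal_transpose,
    map_ofReal_mulVec_eq_zero_iff]
  rw [map_ofReal_mulVec_eq_zero_iff] at hYw
  rw [Matrix.transpose_mul, ← Matrix.mulVec_mulVec, ← Matrix.mulVec_mulVec]
  exact ⟨(ker_invariant_of_lyapunov hX h (hker _ hYw.1)).1,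
    (ker_invariant_of_lyapunov hX h (hker _ hYw.2)).1⟩

/-- The Popov–Belevitch–Hautus test. -/
theorem IsHurwitz.vecMul_ne_zero {A : Matrix κ κ ℝ} {B : Matrix κ μ ℝ} {F : Matrix μ κ ℝ}
    (hF : IsHurwitz (A + B * F)) {z : ℂ} (hz : 0 ≤ z.re) {w : κ → ℂ} (hw0 : w ≠ 0)
    (hw : w ᵥ* A.map Complex.ofReal = z • w) : w ᵥ* B.map Complex.ofReal ≠ 0 := by
  intro hB
  refine absurd (hF z ((mem_eigenvalues_iff_vecMul _ z).2 ⟨w, hw0, ?_⟩)) (not_lt.2 hz)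
  rw [map_ofReal_add, map_ofReal_mul, Matrix.vecMul_add, ← Matrix.vecMul_vecMul, hB,
    Matrix.zero_vecMul, add_zero, hw]

theorem vecMul_left_inverse_ne_zero {L : Matrix κ ι ℝ} {J : Matrix ι κ ℝ} (hLJ : L * J = 1)
    {w : κ → ℂ} (hw : w ≠ 0) : w ᵥ* L.map Complex.ofReal ≠ 0 := by
  intro h
  refine hw ?_
  have h1 : w ᵥ* (L * J).map Complex.ofReal = w := by
    rw [hLJ, Matrix.map_one _ Complex.ofReal_zero Complex.ofReal_one, Matrix.vecMul_one]
  rw [← h1, map_ofReal_mul, ← Matrix.vecMul_vecMul, h, Matrix.zero_vecMul]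

omit [DecidableEq κ] in
theorem vecMul_intertwine {L : Matrix κ ι ℝ} {M : Matrix ι ι ℝ} {U : Matrix κ κ ℝ}
    (h : L * M = U * L) {z : ℂ} {w : κ → ℂ} (hw : w ᵥ* U.map Complex.ofReal = z • w) :
    (w ᵥ* L.map Complex.ofReal) ᵥ* M.map Complex.ofReal = z • (w ᵥ* L.map Complex.ofReal) := by
  rw [Matrix.vecMul_vecMul, ← map_ofReal_mul, h, map_ofReal_mul, ← Matrix.vecMul_vecMul, hw,
    Matrix.smul_vecMul]

/-- Lower bound for the transmitted power, by completing the square. -/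
theorem two_mul_trace_le_trace {A X : Matrix ι ι ℝ} {B : Matrix ι μ ℝ} {F : Matrix μ ι ℝ}
    {V : Matrix ι ν ℝ} {T : Matrix ν μ ℝ} {L : Matrix κ ι ℝ} {U : Matrix κ κ ℝ}
    (hX : X.PosSemidef) (h : (A + B * F) * X + X * (A + B * F)ᵀ + V * Vᵀ = 0)
    (hVT : V * T = B) (hL : L * A = U * L) (hY : (L * X * Lᵀ).PosDef) :
    2 * U.trace ≤ (T * F * X * (T * F)ᵀ).trace := by
  have hXt : Xᵀ = X := by
    have := hX.isHermitian.eq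
    rwa [Matrix.conjTranspose_eq_transpose_of_trivial] at this
  set Y := L * X * Lᵀ with hYdef
  have hYt : Yᵀ = Y := by
    rw [hYdef, Matrix.transpose_mul, Matrix.transpose_mul, Matrix.transpose_transpose, hXt,
      Matrix.mul_assoc]
  have hYdet : IsUnit Y.det := (Matrix.isUnit_iff_isUnit_det _).1 hY.isUnit
  set Z := Y⁻¹ with hZ
  have hZt : Zᵀ = Z := by rw [hZ, Matrix.transpose_nonsing_inv, hYt]
  have hYZ : Y * Z = 1 := Matrix.mul_nonsing_inv _ hYdet
  -- The Lyapunov equation compressed to the quotient; it is next multiplied by `Z = Y⁻¹` and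
  -- traced.
  have h1 : U * Y + L * B * F * X * Lᵀ + (Y * Uᵀ + (L * B * F * X * Lᵀ)ᵀ)
      + L * V * (L * V)ᵀ = 0 := by
    have h2 := congrArg (fun W => L * W * Lᵀ) h
    simp only [Matrix.mul_zero, Matrix.zero_mul] at h2
    rw [← h2, hYdef]
    have h3 : L * X * Lᵀ * Uᵀ = L * X * Aᵀ * Lᵀ := by
      have := congrArg Matrix.transpose hL
      rw [Matrix.transpose_mul, Matrix.transpose_mul] at this
      rw [Matrix.mul_assoc, ← this, Matrix.mul_assoc (L * X)]
    have h4 : U * (L * X * Lᵀ) = L * A * X * Lᵀ := by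
      rw [hL, ← Matrix.mul_assoc, ← Matrix.mul_assoc]
    rw [h3, h4]
    simp only [Matrix.mul_add, Matrix.add_mul, Matrix.transpose_mul, Matrix.transpose_add, hXt,
      Matrix.mul_assoc, Matrix.transpose_transpose]
  have h2 : 2 * U.trace + 2 * (L * B * F * X * Lᵀ * Z).trace
      + (L * V * (L * V)ᵀ * Z).trace = 0 := by
    have h3 := congrArg (fun W => (W * Z).trace) h1
    simp only [Matrix.add_mul, Matrix.trace_add, Matrix.zero_mul, Matrix.trace_zero] at h3
    have h4 : (U * Y * Z).trace = U.trace := by rw [Matrix.mul_assoc, hYZ, Matrix.mul_one]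
    have h5 : (Y * Uᵀ * Z).trace = U.trace := by
      rw [← Matrix.trace_transpose (Y * Uᵀ * Z), Matrix.transpose_mul, Matrix.transpose_mul,
        Matrix.transpose_transpose, hYt, hZt, Matrix.trace_mul_comm, h4]
    have h6 : ((L * B * F * X * Lᵀ)ᵀ * Z).trace = (L * B * F * X * Lᵀ * Z).trace := by
      rw [← Matrix.trace_transpose ((L * B * F * X * Lᵀ)ᵀ * Z), Matrix.transpose_mul,
        Matrix.transpose_transpose, hZt, Matrix.trace_mul_comm]
    rw [h4, h5, h6] at h3
    linarith
  -- The square to complete: `V T = B` makes its cross terms the feedback term of the traced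
  -- equation, and `Z Y Z = Z` makes its last term the noise term.
  have h3 : 0 ≤ ((T * F + Vᵀ * Lᵀ * Z * L) * X * (T * F + Vᵀ * Lᵀ * Z * L)ᵀ).trace := by
    have := (hX.mul_mul_conjTranspose_same (T * F + Vᵀ * Lᵀ * Z * L)).trace_nonneg
    rwa [Matrix.conjTranspose_eq_transpose_of_trivial] at this
  have h4 : (T * F + Vᵀ * Lᵀ * Z * L) * X * (T * F + Vᵀ * Lᵀ * Z * L)ᵀ
      = T * F * X * (T * F)ᵀ + T * F * X * (Lᵀ * Z * L * V)
        + (T * F * X * (Lᵀ * Z * L * V))ᵀ + Vᵀ * Lᵀ * Z * (Y * Z) * L * V := by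
    rw [hYdef]
    simp only [Matrix.mul_add, Matrix.add_mul, Matrix.transpose_mul, Matrix.transpose_add, hXt,
      Matrix.mul_assoc, Matrix.transpose_transpose, hZt]
    abel
  have h5 : (T * F * X * (Lᵀ * Z * L * V)).trace = (L * B * F * X * Lᵀ * Z).trace := by
    rw [← hVT]
    have : T * F * X * (Lᵀ * Z * L * V) = (T * F * X * Lᵀ * Z) * (L * V) := by
      simp only [Matrix.mul_assoc]
    rw [this, Matrix.trace_mul_comm]
    simp only [Matrix.mul_assoc]
  have h6 : (Vᵀ * Lᵀ * Z * (Y * Z) * L * V).trace = (L * V * (L * V)ᵀ * Z).trace := by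
    rw [hYZ, Matrix.mul_one]
    have : Vᵀ * Lᵀ * Z * L * V = ((L * V)ᵀ * Z) * (L * V) := by
      simp only [Matrix.mul_assoc, Matrix.transpose_mul]
    rw [this, Matrix.trace_mul_comm]
    simp only [Matrix.mul_assoc]
  rw [h4, Matrix.trace_add, Matrix.trace_add, Matrix.trace_add, Matrix.trace_transpose, h5,
    h6] at h3
  linarith

end Gramian

theorem topologicalEntropy_eq_trace {ι κ : Type*} [Fintype ι] [DecidableEq ι] [Fintype κ]
    [DecidableEq κ] {M : Matrix ι ι ℝ} {U : Matrix κ κ ℝ}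
    (h : eigenvalues U = (eigenvalues M).filter fun z => 0 < z.re) :
    topologicalEntropy M = U.trace := by
  rw [← re_sum_eigenvalues, h, topologicalEntropy]

/-- Necessity. Scaling by `N^{1/2}` makes the noise white with unit density and the encoder
`N^{-1/2} T`, so the traced power is `∑ E[q_i²] / N_i`. The inequality becomes strict through the
power constraints, as there is at least one channel. -/
theorem topologicalEntropy_lt_totalCapacity {n m l : ℕ} (hl : 0 < l)
    {A : Matrix (Fin n) (Fin n) ℝ} {B : Matrix (Fin n) (Fin m) ℝ}
    {N Pow : Fin l → ℝ} (hN : ∀ i, 0 < N i) (h : IsStabilizableViaAWGN A B N Pow) :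
    topologicalEntropy A < totalCapacity N Pow := by
  obtain ⟨F, T, R, hRT, hH, hP⟩ := h
  obtain ⟨p, L, J, U, hLJ, hLA, hU, -⟩ := exists_spectral_quotient A (fun z => 0 < z.re)
    (fun z hz => by simpa using hz)
  have hcl : closedLoop A B F T R = A + B * F := by
    rw [closedLoop, Matrix.mul_assoc B R T, hRT, Matrix.mul_one]
  set D : Matrix (Fin l) (Fin l) ℝ := Matrix.diagonal fun i => Real.sqrt (N i) with hD
  set D' : Matrix (Fin l) (Fin l) ℝ := Matrix.diagonal fun i => (Real.sqrt (N i))⁻¹ with hD'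
  have hDD' : D * D' = 1 := by
    rw [hD, hD', Matrix.diagonal_mul_diagonal, ← Matrix.diagonal_one]
    congr 1; ext i
    exact mul_inv_cancel₀ (Real.sqrt_pos.2 (hN i)).ne'
  have hDD : D * Dᵀ = Matrix.diagonal N := by
    rw [hD, Matrix.diagonal_transpose, Matrix.diagonal_mul_diagonal]
    congr 1; ext i
    exact Real.mul_self_sqrt (hN i).le
  set V := B * R * D with hV
  have hVV : V * Vᵀ = B * R * Matrix.diagonal N * (B * R)ᵀ := by
    rw [hV, ← hDD, Matrix.transpose_mul (B * R) D]
    simp only [Matrix.mul_assoc]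
  have hVT : V * (D' * T) = B := by
    rw [hV, Matrix.mul_assoc, ← Matrix.mul_assoc D, hDD', Matrix.one_mul, Matrix.mul_assoc, hRT,
      Matrix.mul_one]
  obtain ⟨X, hX⟩ := hH.exists_lyapunov (V * Vᵀ)
  have hVpsd : (V * Vᵀ).PosSemidef := by
    have := Matrix.posSemidef_self_mul_conjTranspose V
    rwa [Matrix.conjTranspose_eq_transpose_of_trivial] at this
  have hXpsd := hH.posSemidef_of_lyapunov hVpsd hX
  have hpow := inputPower_eq hH N (X := X) (by rw [← hVV, hX])
  rw [hcl] at hX hH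
  have hY : (L * X * Lᵀ).PosDef := by
    refine posDef_of_lyapunov hXpsd hX L U (fun v hv => ?_) (fun z w hw0 hw => ?_)
    · have h1 : Bᵀ *ᵥ (Lᵀ *ᵥ v) = 0 := by
        rw [← hVT, Matrix.transpose_mul, ← Matrix.mulVec_mulVec, hv, Matrix.mulVec_zero]
      rw [Matrix.transpose_add, Matrix.transpose_mul, Matrix.add_mulVec,
        ← Matrix.mulVec_mulVec _ Fᵀ, h1, Matrix.mulVec_zero, add_zero, Matrix.mulVec_mulVec,
        Matrix.mulVec_mulVec, ← Matrix.transpose_mul, ← Matrix.transpose_mul, hLA]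
    · intro h0
      have hz : z ∈ eigenvalues U := (mem_eigenvalues_iff_vecMul U z).2 ⟨w, hw0, hw⟩
      rw [hU, Multiset.mem_filter] at hz
      refine hH.vecMul_ne_zero hz.2.le (vecMul_left_inverse_ne_zero hLJ hw0)
        (vecMul_intertwine hLA hw) ?_
      rw [Matrix.vecMul_vecMul, ← map_ofReal_mul, ← hVT, ← Matrix.mul_assoc, map_ofReal_mul,
        ← Matrix.vecMul_vecMul, h0, Matrix.zero_vecMul]
  have hmain := two_mul_trace_le_trace hXpsd hX hVT hLA hY
  have htr : (D' * T * F * X * (D' * T * F)ᵀ).trace = ∑ i, inputPower A B F T R N i / N i := by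
    rw [Matrix.trace]
    refine Finset.sum_congr rfl fun i _ => ?_
    have h1 : D' * T * F * X * (D' * T * F)ᵀ = D' * (T * F * X * (T * F)ᵀ) * D' := by
      rw [Matrix.mul_assoc D', Matrix.transpose_mul D']
      have : D'ᵀ = D' := by rw [hD', Matrix.diagonal_transpose]
      rw [this]
      simp only [Matrix.mul_assoc]
    rw [Matrix.diag_apply, h1, hD', Matrix.mul_diagonal, Matrix.diagonal_mul, hpow]
    have h2 : (Real.sqrt (N i))⁻¹ * (Real.sqrt (N i))⁻¹ = (N i)⁻¹ := by
      rw [← mul_inv, Real.mul_self_sqrt (hN i).le]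
    rw [div_eq_mul_inv, ← h2]; ring
  rw [htr, ← topologicalEntropy_eq_trace hU] at hmain
  have hlt : ∑ i, inputPower A B F T R N i / N i < ∑ i, Pow i / N i := by
    refine Finset.sum_lt_sum_of_nonempty ⟨⟨0, hl⟩, Finset.mem_univ _⟩ fun i _ => ?_
    exact div_lt_div_of_pos_right (hP i) (hN i)
  have hC : totalCapacity N Pow = 1 / 2 * ∑ i, Pow i / N i := by
    rw [totalCapacity, Finset.mul_sum]; rfl
  rw [hC]
  linarith


/-! ### Stabilization by Gramian feedback -/

open Matrix

section Stability

variable {κ μ : Type*} [Fintype κ] [DecidableEq κ] [Fintype μ]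

open scoped ComplexOrder in
theorem posDef_map_ofReal {Q : Matrix κ κ ℝ} (hQ : Q.PosDef) :
    (Q.map Complex.ofReal).PosDef := by
  rw [(posSemidef_map_ofReal hQ.posSemidef).posDef_iff_isUnit, Matrix.isUnit_iff_isUnit_det]
  have h1 := (Matrix.isUnit_iff_isUnit_det _).1 hQ.isUnit
  have h2 := RingHom.map_det Complex.ofRealHom Q
  have h3 := h1.map Complex.ofRealHom
  rw [h2] at h3
  exact h3

open scoped ComplexOrder in
-- Evaluating the equation on a left eigenvector `w` gives `2 Re z · (w Y w*) = -(w W w*) < 0`.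
theorem isHurwitz_of_lyapunov {M Y W : Matrix κ κ ℝ} (hY : Y.PosDef) (hW : W.PosDef)
    (h : M * Y + Y * Mᵀ + W = 0) : IsHurwitz M := by
  intro z hz
  obtain ⟨w, hw0, hw⟩ := (mem_eigenvalues_iff_vecMul M z).1 hz
  set x := star w with hx
  have hx0 : x ≠ 0 := fun h0 => hw0 (by rw [← star_star w, ← hx, h0, star_zero])
  have hwx : star x = w := star_star w
  have hYx := (posDef_map_ofReal hY).dotProduct_mulVec_pos hx0
  have hWx := (posDef_map_ofReal hW).dotProduct_mulVec_pos hx0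
  rw [hwx] at hYx hWx
  have h1 : Mᵀ.map Complex.ofReal *ᵥ x = star z • x := by
    rw [← conjTranspose_map_ofReal, hx, ← Matrix.star_vecMul, hw, star_smul]
  have h2 := congrArg (fun V : Matrix κ κ ℝ => w ⬝ᵥ (V.map Complex.ofReal *ᵥ x)) h
  simp only [map_ofReal_add, map_ofReal_mul, Matrix.add_mulVec, dotProduct_add,
    Matrix.map_zero _ Complex.ofReal_zero, Matrix.zero_mulVec, dotProduct_zero] at h2
  rw [← Matrix.mulVec_mulVec, ← Matrix.mulVec_mulVec, h1, Matrix.dotProduct_mulVec w, hw,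
    Matrix.mulVec_smul, smul_dotProduct, dotProduct_smul, smul_eq_mul, smul_eq_mul] at h2
  have h3 := congrArg Complex.re h2
  have hY1 := Complex.lt_def.1 hYx
  have hW1 := Complex.lt_def.1 hWx
  simp only [Complex.zero_re, Complex.zero_im] at hY1 hW1
  simp only [Complex.add_re, Complex.mul_re, ← hY1.2, Complex.zero_re, mul_zero, sub_zero,
    Complex.star_def, Complex.conj_re] at h3
  nlinarith [hY1.1, hW1.1]

omit [Fintype κ] in
theorem map_ofReal_neg_add_smul_one (M : Matrix κ κ ℝ) (δ : ℝ) :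
    (-(M + δ • (1 : Matrix κ κ ℝ))).map Complex.ofReal
      = -(M.map Complex.ofReal) - (δ : ℂ) • (1 : Matrix κ κ ℂ) := by
  ext i j
  by_cases hij : i = j <;> simp [hij, sub_eq_add_neg, add_comm]

/-- The shift by `δ` pushes eigenvalues on the imaginary axis strictly to the right, so that a
Gramian exists for them as well. -/
theorem isHurwitz_neg_add_smul_one {M : Matrix κ κ ℝ} (hM : ∀ z ∈ eigenvalues M, 0 ≤ z.re)
    {δ : ℝ} (hδ : 0 < δ) : IsHurwitz (-(M + δ • (1 : Matrix κ κ ℝ))) := by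
  intro z hz
  obtain ⟨v, hv0, hv⟩ := (mem_eigenvalues_iff_mulVec _ z).1 hz
  have h1 : M.map Complex.ofReal *ᵥ v = (-z - δ) • v := by
    rw [map_ofReal_neg_add_smul_one, Matrix.sub_mulVec, Matrix.neg_mulVec, Matrix.smul_mulVec, Matrix.one_mulVec] at hv
    rw [sub_smul, neg_smul, ← hv]
    abel
  have h2 := hM _ ((mem_eigenvalues_iff_mulVec M _).2 ⟨v, hv0, h1⟩)
  simp at h2
  linarith

/-- The Gramian of the antistable pair `[M + δ | V]`. -/
theorem exists_gramian {M : Matrix κ κ ℝ} (hM : ∀ z ∈ eigenvalues M, 0 ≤ z.re)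
    {δ : ℝ} (hδ : 0 < δ) {V : Matrix κ μ ℝ}
    (hV : ∀ (z : ℂ) (w : κ → ℂ), w ≠ 0 → w ᵥ* M.map Complex.ofReal = z • w →
      w ᵥ* V.map Complex.ofReal ≠ 0) :
    ∃ Y : Matrix κ κ ℝ, Y.PosDef ∧
      (M + δ • (1 : Matrix κ κ ℝ)) * Y + Y * (M + δ • (1 : Matrix κ κ ℝ))ᵀ = V * Vᵀ ∧
      (Vᵀ * Y⁻¹ * V).trace = 2 * M.trace + 2 * δ * Fintype.card κ := by
  have hH := isHurwitz_neg_add_smul_one hM hδ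
  set S := M + δ • (1 : Matrix κ κ ℝ) with hS
  obtain ⟨Y, hY⟩ := hH.exists_lyapunov (V * Vᵀ)
  have hVpsd : (V * Vᵀ).PosSemidef := by
    have := Matrix.posSemidef_self_mul_conjTranspose V
    rwa [Matrix.conjTranspose_eq_transpose_of_trivial] at this
  have hYpsd := hH.posSemidef_of_lyapunov hVpsd hY
  have hYeq : S * Y + Y * Sᵀ = V * Vᵀ := by
    rw [Matrix.transpose_neg, Matrix.neg_mul, Matrix.mul_neg, ← neg_add,
      neg_add_eq_zero] at hY
    exact hY
  have hpd : Y.PosDef := by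
    have := posDef_of_lyapunov hYpsd hY 1 (-S) (fun v _ => by simp) (fun z w hw0 hw => by
      rw [Matrix.one_mul]
      refine hV (-z - δ) w hw0 ?_
      rw [map_ofReal_neg_add_smul_one, Matrix.vecMul_sub, Matrix.vecMul_neg, Matrix.vecMul_smul,
        Matrix.vecMul_one] at hw
      rw [sub_smul, neg_smul, ← hw]
      abel)
    simpa using this
  refine ⟨Y, hpd, hYeq, ?_⟩
  have hYdet : IsUnit Y.det := (Matrix.isUnit_iff_isUnit_det _).1 hpd.isUnit
  have hYt : Yᵀ = Y := by
    have := hpd.isHermitian.eq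
    rwa [Matrix.conjTranspose_eq_transpose_of_trivial] at this
  rw [Matrix.mul_assoc, Matrix.trace_mul_comm, Matrix.mul_assoc, Matrix.trace_mul_comm, ← hYeq,
    Matrix.add_mul, Matrix.trace_add, Matrix.mul_assoc, Matrix.mul_nonsing_inv _ hYdet,
    Matrix.mul_one, Matrix.trace_mul_comm, ← Matrix.mul_assoc, Matrix.nonsing_inv_mul _ hYdet,
    Matrix.one_mul, Matrix.trace_transpose, hS, Matrix.trace_add, Matrix.trace_smul,
    Matrix.trace_one, smul_eq_mul]
  ring

/-- The feedback `-Vᵀ Y⁻¹` given by the Gramian is stabilizing, and the covariance of the state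
is bounded by the Gramian. -/
theorem gramian_feedback {M : Matrix κ κ ℝ} {δ : ℝ} (hδ : 0 < δ) {V : Matrix κ μ ℝ}
    {Y : Matrix κ κ ℝ} (hY : Y.PosDef)
    (h : (M + δ • (1 : Matrix κ κ ℝ)) * Y + Y * (M + δ • (1 : Matrix κ κ ℝ))ᵀ = V * Vᵀ) :
    IsHurwitz (M - V * Vᵀ * Y⁻¹) ∧ ∀ X, (M - V * Vᵀ * Y⁻¹) * X + X * (M - V * Vᵀ * Y⁻¹)ᵀ
      + V * Vᵀ = 0 → (Y - X).PosSemidef := by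
  have hYdet : IsUnit Y.det := (Matrix.isUnit_iff_isUnit_det _).1 hY.isUnit
  have hYt : Yᵀ = Y := by
    have := hY.isHermitian.eq
    rwa [Matrix.conjTranspose_eq_transpose_of_trivial] at this
  have hVpsd : (V * Vᵀ).PosSemidef := by
    have := Matrix.posSemidef_self_mul_conjTranspose V
    rwa [Matrix.conjTranspose_eq_transpose_of_trivial] at this
  have hδY : ((2 * δ) • Y).PosDef := hY.smul (by positivity)
  -- The Gramian solves the closed-loop equation with the extra noise `2δ Y`. This gives stability,
  -- and subtracting the equation of `X` makes `Y - X` the covariance of that extra noise.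
  have h1 : (M - V * Vᵀ * Y⁻¹) * Y + Y * (M - V * Vᵀ * Y⁻¹)ᵀ + V * Vᵀ + (2 * δ) • Y = 0 := by
    have h2 : V * Vᵀ * Y⁻¹ * Y = V * Vᵀ := by
      rw [Matrix.mul_assoc, Matrix.nonsing_inv_mul _ hYdet, Matrix.mul_one]
    have h3 : Y * (V * Vᵀ * Y⁻¹)ᵀ = V * Vᵀ := by
      rw [Matrix.transpose_mul, Matrix.transpose_nonsing_inv, hYt, ← Matrix.mul_assoc,
        Matrix.mul_nonsing_inv _ hYdet, Matrix.one_mul, Matrix.transpose_mul,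
        Matrix.transpose_transpose]
    have h4 : M * Y + Y * Mᵀ + (2 * δ) • Y = V * Vᵀ := by
      rw [← h, Matrix.transpose_add, Matrix.transpose_smul, Matrix.transpose_one, Matrix.add_mul,
        Matrix.mul_add, Matrix.smul_mul, Matrix.mul_smul, Matrix.one_mul, Matrix.mul_one, two_mul,
        add_smul]
      abel
    rw [Matrix.sub_mul, h2, Matrix.transpose_sub, Matrix.mul_sub, h3, ← h4]
    abel
  have hH : IsHurwitz (M - V * Vᵀ * Y⁻¹) :=
    isHurwitz_of_lyapunov hY (hδY.posSemidef_add hVpsd) (by rw [← add_assoc]; exact h1)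
  refine ⟨hH, fun X hX => hH.posSemidef_of_lyapunov hδY.posSemidef ?_⟩
  generalize M - V * Vᵀ * Y⁻¹ = G at h1 hX
  calc G * (Y - X) + (Y - X) * Gᵀ + (2 * δ) • Y
      = (G * Y + Y * Gᵀ + V * Vᵀ + (2 * δ) • Y) - (G * X + X * Gᵀ + V * Vᵀ) := by
        rw [Matrix.mul_sub, Matrix.sub_mul]; abel
    _ = 0 := by rw [h1, hX, sub_zero]

end Stability

/-! ### Allocating the power to the channels -/

section Allocation

/-- Write `S` as a sum of squares, split off the `i`-th coordinate by Young's inequality with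
parameter `θ`, and bound the rest by Cauchy–Schwarz. Only diagonal entries of `S` remain. -/
theorem posSemidef_quadratic_le {m : ℕ} {S : Matrix (Fin m) (Fin m) ℝ} (hS : S.PosSemidef)
    (i : Fin m) {q : Fin m → ℝ} (hq : ∀ j, q j ^ 2 ≤ 1) {θ : ℝ} (hθ : 0 < θ) :
    q ⬝ᵥ (S *ᵥ q) ≤ (1 + θ) * q i ^ 2 * S i i
      + (1 + θ⁻¹) * m * ∑ j ∈ Finset.univ.erase i, S j j := by
  obtain ⟨r, v, hv⟩ := Matrix.posSemidef_iff_eq_sum_vecMulVec.1 hS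
  have hdiag : ∀ j, S j j = ∑ s, v s j ^ 2 := by
    intro j
    rw [hv, Matrix.sum_apply]
    refine Finset.sum_congr rfl fun s _ => ?_
    simp [Matrix.vecMulVec_apply, pow_two]
  have hquad : q ⬝ᵥ (S *ᵥ q) = ∑ s, (∑ j, v s j * q j) ^ 2 := by
    rw [hv, Matrix.sum_mulVec, dotProduct_sum]
    refine Finset.sum_congr rfl fun s _ => ?_
    rw [Matrix.vecMulVec_mulVec]
    simp only [star_trivial, dotProduct, Pi.smul_apply, MulOpposite.smul_eq_mul_unop,
      MulOpposite.unop_op]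
    simp only [← mul_assoc]
    rw [← Finset.sum_mul, pow_two]
    congr 1
    exact Finset.sum_congr rfl fun j _ => mul_comm _ _
  have hterm : ∀ s, (∑ j, v s j * q j) ^ 2 ≤ (1 + θ) * q i ^ 2 * v s i ^ 2
      + (1 + θ⁻¹) * m * ∑ j ∈ Finset.univ.erase i, v s j ^ 2 := by
    intro s
    rw [← Finset.add_sum_erase _ _ (Finset.mem_univ i)]
    set a := v s i * q i with ha
    set b := ∑ j ∈ Finset.univ.erase i, v s j * q j
    have hb : b ^ 2 ≤ m * ∑ j ∈ Finset.univ.erase i, v s j ^ 2 := by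
      refine (sq_sum_le_card_mul_sum_sq (s := Finset.univ.erase i)
        (f := fun j => v s j * q j)).trans ?_
      have hc : ((Finset.univ.erase i).card : ℝ) ≤ m := by
        exact_mod_cast (Finset.card_erase_le).trans (by simp)
      have hs : ∑ j ∈ Finset.univ.erase i, (v s j * q j) ^ 2
          ≤ ∑ j ∈ Finset.univ.erase i, v s j ^ 2 := by
        refine Finset.sum_le_sum fun j _ => ?_
        rw [mul_pow]
        exact mul_le_of_le_one_right (sq_nonneg _) (hq j)
      exact mul_le_mul hc hs (Finset.sum_nonneg fun j _ => sq_nonneg _) (by positivity)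
    have hab : (a + b) ^ 2 ≤ (1 + θ) * a ^ 2 + (1 + θ⁻¹) * b ^ 2 := by
      have h1 : 0 ≤ θ⁻¹ * (θ * a - b) ^ 2 := by positivity
      have h2 : θ⁻¹ * (θ * a - b) ^ 2 = θ * a ^ 2 - 2 * a * b + θ⁻¹ * b ^ 2 := by
        field_simp
        ring
      nlinarith
    have hθ' : 0 < 1 + θ⁻¹ := by positivity
    calc (a + b) ^ 2 ≤ (1 + θ) * a ^ 2 + (1 + θ⁻¹) * b ^ 2 := hab
      _ ≤ (1 + θ) * a ^ 2
          + (1 + θ⁻¹) * (m * ∑ j ∈ Finset.univ.erase i, v s j ^ 2) := by gcongr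
      _ = _ := by rw [ha]; ring
  rw [hquad, hdiag i]
  calc _ ≤ ∑ s, ((1 + θ) * q i ^ 2 * v s i ^ 2
      + (1 + θ⁻¹) * m * ∑ j ∈ Finset.univ.erase i, v s j ^ 2) :=
        Finset.sum_le_sum fun s _ => hterm s
    _ = _ := by
      rw [Finset.sum_add_distrib, ← Finset.mul_sum, ← Finset.mul_sum, Finset.sum_comm]
      simp only [hdiag]

/-- Extend the unit vector `t`, placed at index `i`, to an orthonormal basis of `ℝ^l` and keep the
first `m` vectors. -/
theorem exists_orthonormal_columns {m l : ℕ} (hml : m ≤ l) (i : Fin m) {t : Fin l → ℝ}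
    (ht : ∑ a, t a ^ 2 = 1) :
    ∃ Q : Matrix (Fin l) (Fin m) ℝ, Qᵀ * Q = 1 ∧ ∀ a, Q a i = t a := by
  set v : Fin l → EuclideanSpace ℝ (Fin l) := fun _ => WithLp.toLp 2 t
  have hv : Orthonormal ℝ (({Fin.castLE hml i} : Set (Fin l)).domRestrict v) := by
    constructor
    · intro a
      have : ‖(WithLp.toLp 2 t : EuclideanSpace ℝ (Fin l))‖ = 1 := by
        rw [EuclideanSpace.norm_eq]
        simp [ht]
      exact this
    · intro a b hab
      exact absurd (Subsingleton.elim a b) hab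
  obtain ⟨b, hb⟩ := hv.exists_orthonormalBasis_extension_of_card_eq (by simp)
  refine ⟨Matrix.of fun a j => b (Fin.castLE hml j) a, ?_, fun a => ?_⟩
  · ext j k
    have h1 := orthonormal_iff_ite.1 b.orthonormal (Fin.castLE hml j) (Fin.castLE hml k)
    rw [Matrix.one_apply, Matrix.mul_apply]
    simp only [PiLp.inner_apply, RCLike.inner_apply, conj_trivial, Fin.castLE_inj] at h1
    rw [← h1]
    exact Finset.sum_congr rfl fun a _ => mul_comm _ _
  · have := hb (Fin.castLE hml i) rfl
    simp [this, v]

theorem exists_invertible_column {m : ℕ} (i : Fin m) {k : Fin m → ℝ} (hk : k ≠ 0) :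
    ∃ K K' : Matrix (Fin m) (Fin m) ℝ, K * K' = 1 ∧ ∀ a, K a i = k a := by
  have hs : (Pi.single i 1 : Fin m → ℝ) ≠ 0 := by simp
  obtain ⟨e, he⟩ := SeparatingDual.exists_continuousLinearEquiv_apply_eq (R := ℝ) hs hk
  refine ⟨LinearMap.toMatrix' e.toLinearEquiv.toLinearMap,
    LinearMap.toMatrix' e.symm.toLinearEquiv.toLinearMap, ?_, fun a => ?_⟩
  · rw [← LinearMap.toMatrix'_comp, ← LinearMap.toMatrix'_id]
    congr 1
    ext x : 1
    simp
  · rw [LinearMap.toMatrix'_apply]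
    rw [← he]
    congr 2

end Allocation


/-! ### Feedback concentrated in one input direction -/

open Matrix

/-- Eigenvalues on the imaginary axis contribute zero, so the quotient for the closed half-plane
still has trace `H(A)`. -/
theorem sum_re_filter_nonneg (s : Multiset ℂ) :
    ((s.filter fun z => 0 ≤ z.re).map Complex.re).sum
      = ((s.filter fun z => 0 < z.re).map Complex.re).sum := by
  induction s using Multiset.induction_on with
  | empty => rfl
  | cons a s ih =>
    rcases lt_trichotomy 0 a.re with h | h | h
    · rw [Multiset.filter_cons_of_pos (p := fun z : ℂ => 0 ≤ z.re) s h.le,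
        Multiset.filter_cons_of_pos (p := fun z : ℂ => 0 < z.re) s h]
      simp [ih]
    · rw [Multiset.filter_cons_of_pos (p := fun z : ℂ => 0 ≤ z.re) s h.le,
        Multiset.filter_cons_of_neg (p := fun z : ℂ => 0 < z.re) s h.not_lt]
      simp [ih, ← h]
    · rw [Multiset.filter_cons_of_neg (p := fun z : ℂ => 0 ≤ z.re) s (not_le.2 h),
        Multiset.filter_cons_of_neg (p := fun z : ℂ => 0 < z.re) s h.not_gt]
      exact ih

section Feedback

variable {n m : ℕ} {A : Matrix (Fin n) (Fin n) ℝ} {B : Matrix (Fin n) (Fin m) ℝ}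

/-- Feedback of a spectral quotient that contains all unstable modes stabilizes the plant. -/
theorem isHurwitz_of_quotient {p : ℕ} {L : Matrix (Fin p) (Fin n) ℝ}
    {U : Matrix (Fin p) (Fin p) ℝ} {G : Matrix (Fin m) (Fin p) ℝ} (hL : L * A = U * L)
    (hker : ∀ (z : ℂ) (v : Fin n → ℂ), v ≠ 0 → A.map Complex.ofReal *ᵥ v = z • v →
      L.map Complex.ofReal *ᵥ v = 0 → ¬ 0 ≤ z.re)
    (hU : IsHurwitz (U + L * B * G)) : IsHurwitz (A + B * (G * L)) := by
  intro z hz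
  obtain ⟨v, hv0, hv⟩ := (mem_eigenvalues_iff_mulVec _ z).1 hz
  by_cases hu : L.map Complex.ofReal *ᵥ v = 0
  · refine not_le.1 (hker z v hv0 ?_ hu)
    rwa [map_ofReal_add, ← Matrix.mul_assoc, map_ofReal_mul, Matrix.add_mulVec,
      ← Matrix.mulVec_mulVec, hu, Matrix.mulVec_zero, add_zero] at hv
  · refine hU z ((mem_eigenvalues_iff_mulVec _ z).2 ⟨_, hu, ?_⟩)
    have h1 : (U + L * B * G) * L = L * (A + B * (G * L)) := by
      rw [Matrix.add_mul, Matrix.mul_add, hL]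
      simp only [Matrix.mul_assoc]
    rw [Matrix.mulVec_mulVec, ← map_ofReal_mul, h1, map_ofReal_mul, ← Matrix.mulVec_mulVec, hv,
      Matrix.mulVec_smul]

/-- Lower bound for `bᵀ Y⁻¹ b` in terms of a compression `L Y Lᵀ = Y₁ + E` of the Gramian. -/
theorem trace_le_trace_gramian_feedback {κ ρ μ : Type*} [Fintype κ] [DecidableEq κ]
    [Fintype ρ] [DecidableEq ρ] [Fintype μ] {Y : Matrix κ κ ℝ} (hY : Y.PosDef)
    {Y₁ : Matrix ρ ρ ℝ} (hY₁ : Y₁.PosDef) {L : Matrix ρ κ ℝ} {E : Matrix ρ ρ ℝ}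
    (hL : L * Y * Lᵀ = Y₁ + E) (b : Matrix κ μ ℝ) :
    ((L * b)ᵀ * Y₁⁻¹ * (L * b)).trace - ((L * b)ᵀ * Y₁⁻¹ * E * Y₁⁻¹ * (L * b)).trace
      ≤ (bᵀ * Y⁻¹ * b).trace := by
  have hYdet : IsUnit Y.det := (Matrix.isUnit_iff_isUnit_det _).1 hY.isUnit
  have hYt : Yᵀ = Y := by
    have := hY.isHermitian.eq
    rwa [Matrix.conjTranspose_eq_transpose_of_trivial] at this
  have hY₁det : IsUnit Y₁.det := (Matrix.isUnit_iff_isUnit_det _).1 hY₁.isUnit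
  have hY₁t : Y₁ᵀ = Y₁ := by
    have := hY₁.isHermitian.eq
    rwa [Matrix.conjTranspose_eq_transpose_of_trivial] at this
  have hZt : (Y⁻¹)ᵀ = Y⁻¹ := by rw [Matrix.transpose_nonsing_inv, hYt]
  have hZ₁t : (Y₁⁻¹)ᵀ = Y₁⁻¹ := by rw [Matrix.transpose_nonsing_inv, hY₁t]
  have hYZ : Y * Y⁻¹ = 1 := Matrix.mul_nonsing_inv _ hYdet
  have hZY : Y⁻¹ * Y = 1 := Matrix.nonsing_inv_mul _ hYdet
  have hZY₁ : Y₁⁻¹ * Y₁ = 1 := Matrix.nonsing_inv_mul _ hY₁det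
  set β := L * b with hβ
  set x := Lᵀ * Y₁⁻¹ * β with hx
  have h1 : 0 ≤ ((Y⁻¹ * b - x)ᵀ * Y * (Y⁻¹ * b - x)).trace := by
    have := (hY.posSemidef.conjTranspose_mul_mul_same (Y⁻¹ * b - x)).trace_nonneg
    rwa [Matrix.conjTranspose_eq_transpose_of_trivial] at this
  have h2 : (Y⁻¹ * b - x)ᵀ * Y * (Y⁻¹ * b - x)
      = bᵀ * Y⁻¹ * b - xᵀ * b - (xᵀ * b)ᵀ + xᵀ * Y * x := by
    have e1 : (Y⁻¹ * b)ᵀ * Y * (Y⁻¹ * b) = bᵀ * Y⁻¹ * b := by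
      rw [Matrix.transpose_mul, hZt, Matrix.mul_assoc bᵀ, hZY, Matrix.mul_one, Matrix.mul_assoc]
    have e2 : xᵀ * Y * (Y⁻¹ * b) = xᵀ * b := by
      rw [Matrix.mul_assoc, ← Matrix.mul_assoc Y, hYZ, Matrix.one_mul]
    have e3 : (Y⁻¹ * b)ᵀ * Y * x = (xᵀ * b)ᵀ := by
      rw [Matrix.transpose_mul, hZt, Matrix.mul_assoc bᵀ, hZY, Matrix.mul_one,
        Matrix.transpose_mul, Matrix.transpose_transpose]
    rw [Matrix.transpose_sub, Matrix.sub_mul, Matrix.sub_mul, Matrix.mul_sub, Matrix.mul_sub, e1,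
      e2, e3]
    abel
  have hxt : xᵀ = βᵀ * Y₁⁻¹ * L := by
    rw [hx, Matrix.transpose_mul, Matrix.transpose_mul Lᵀ, hZ₁t, Matrix.transpose_transpose,
      Matrix.mul_assoc]
  have h3 : xᵀ * b = βᵀ * Y₁⁻¹ * β := by
    rw [hxt, hβ]
    simp only [Matrix.mul_assoc]
  have h4 : xᵀ * Y * x = βᵀ * Y₁⁻¹ * β + βᵀ * Y₁⁻¹ * E * Y₁⁻¹ * β := by
    have : xᵀ * Y * x = βᵀ * Y₁⁻¹ * (L * Y * Lᵀ) * Y₁⁻¹ * β := by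
      rw [hxt, hx]
      simp only [Matrix.mul_assoc]
    rw [this, hL, Matrix.mul_add, Matrix.mul_assoc βᵀ Y₁⁻¹ Y₁, hZY₁, Matrix.mul_one,
      Matrix.add_mul, Matrix.add_mul]
  rw [h2, Matrix.trace_add, Matrix.trace_sub, Matrix.trace_sub, Matrix.trace_transpose, h4,
    Matrix.trace_add, h3] at h1
  linarith

/-- If the plant is stabilizable and all its strictly unstable modes are controllable through the
single input direction `k`, then, in suitable coordinates of the input space, it can be stabilized
with nearly all of the minimal power in the `i`-th coordinate. -/
theorem exists_feedback_of_input_direction (hstab : IsStabilizable A B) (i : Fin m)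
    {k : Fin m → ℝ} (hk0 : k ≠ 0)
    (hk : ∀ (z : ℂ) (w : Fin n → ℂ), 0 < z.re → w ≠ 0 → w ᵥ* A.map Complex.ofReal = z • w →
      (w ᵥ* B.map Complex.ofReal) ⬝ᵥ (fun a => (k a : ℂ)) ≠ 0) {η : ℝ} (hη : 0 < η) :
    ∃ (G : Matrix (Fin m) (Fin n) ℝ) (S S' W : Matrix (Fin m) (Fin m) ℝ),
      S * S' = 1 ∧ W.PosSemidef ∧ IsHurwitz (A + B * (S' * G)) ∧
      (∀ X : Matrix (Fin n) (Fin n) ℝ, (A + B * (S' * G)) * X + X * (A + B * (S' * G))ᵀ + B * S' * (B * S')ᵀ = 0 →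
        (W - G * X * Gᵀ).PosSemidef) ∧
      W i i ≤ 2 * topologicalEntropy A + η ∧ ∑ j ∈ Finset.univ.erase i, W j j ≤ η := by
  obtain ⟨F₀, hF₀⟩ := hstab
  obtain ⟨K, K', hKK', hKi⟩ := exists_invertible_column i hk0
  -- Two nested quotients: `A'` carries every mode that feedback must move, while `U` carries the
  -- strictly unstable ones, which alone contribute to the entropy and are the ones reachable
  -- through `k`.
  obtain ⟨p', L', J', A', hLJ', hLA', hA', hker⟩ := exists_spectral_quotient A
    (fun z => 0 ≤ z.re) (fun z hz => by simpa using hz)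
  obtain ⟨p, L, J, U, hLJ, hLA, hU, -⟩ := exists_spectral_quotient A'
    (fun z => 0 < z.re) (fun z hz => by simpa using hz)
  have hA'0 : ∀ z ∈ eigenvalues A', 0 ≤ z.re := fun z hz => by
    rw [hA', Multiset.mem_filter] at hz; exact hz.2
  have hU0 : ∀ z ∈ eigenvalues U, 0 < z.re := fun z hz => by
    rw [hU, Multiset.mem_filter] at hz; exact hz.2
  have htrA' : A'.trace = topologicalEntropy A := by
    rw [← re_sum_eigenvalues, hA', sum_re_filter_nonneg]; rfl
  have htrU : U.trace = topologicalEntropy A := by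
    rw [← topologicalEntropy_eq_trace hU, topologicalEntropy, hA', Multiset.filter_filter,
      topologicalEntropy]
    congr 3
    ext z
    exact ⟨fun h => h.1, fun h => ⟨h, h.le⟩⟩
  set δ := η / (4 * (p' + 1)) with hδ_def
  have hδ : 0 < δ := by positivity
  have hδp : 2 * δ * p' ≤ η / 2 := by
    have : δ * (4 * (p' + 1)) = η := by rw [hδ_def]; field_simp
    nlinarith
  set D₁ : Matrix (Fin m) (Fin m) ℝ := Matrix.diagonal fun j => if j = i then 1 else 0 with hD₁
  set D₀ : Matrix (Fin m) (Fin m) ℝ := Matrix.diagonal fun j => if j = i then 0 else 1 with hD₀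
  have hD₁₁ : D₁ * D₁ = D₁ := by
    rw [hD₁, Matrix.diagonal_mul_diagonal]; congr 1; ext j; split_ifs <;> simp
  have hD₀₀ : D₀ * D₀ = D₀ := by
    rw [hD₀, Matrix.diagonal_mul_diagonal]; congr 1; ext j; split_ifs <;> simp
  have hD₀₁ : D₀ * D₁ = 0 := by
    rw [hD₀, hD₁, Matrix.diagonal_mul_diagonal, ← Matrix.diagonal_zero]; congr 1; ext j
    split_ifs <;> simp
  have hD₁₀ : D₁ * D₀ = 0 := by
    rw [hD₀, hD₁, Matrix.diagonal_mul_diagonal, ← Matrix.diagonal_zero]; congr 1; ext j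
    split_ifs <;> simp
  have hD₁t : D₁ᵀ = D₁ := Matrix.diagonal_transpose _
  have hD₀t : D₀ᵀ = D₀ := Matrix.diagonal_transpose _
  have hD : D₁ + D₀ = 1 := by
    rw [hD₀, hD₁, Matrix.diagonal_add, ← Matrix.diagonal_one]; congr 1; ext j
    split_ifs <;> simp
  set b := L' * B * K * D₁ with hb
  have hβobs : ∀ (z : ℂ) (w : Fin p → ℂ), w ≠ 0 → w ᵥ* U.map Complex.ofReal = z • w →
      w ᵥ* (L * b).map Complex.ofReal ≠ 0 := by
    intro z w hw0 hw h0
    have hz := hU0 z ((mem_eigenvalues_iff_vecMul U z).2 ⟨w, hw0, hw⟩)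
    refine hk z _ hz (vecMul_left_inverse_ne_zero hLJ' (vecMul_left_inverse_ne_zero hLJ hw0))
      (vecMul_intertwine hLA' (vecMul_intertwine hLA hw)) ?_
    have h1 := congrFun h0 i
    have h2 : (fun a => ((K * D₁).map Complex.ofReal) a i) = fun a => (k a : ℂ) := by
      funext a
      rw [Matrix.map_apply, hD₁, Matrix.mul_diagonal, if_pos rfl, mul_one, hKi]
    have h3 : (L * b).map Complex.ofReal = L.map Complex.ofReal * L'.map Complex.ofReal
        * B.map Complex.ofReal * (K * D₁).map Complex.ofReal := by
      rw [← map_ofReal_mul, ← map_ofReal_mul, ← map_ofReal_mul, hb]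
      simp only [Matrix.mul_assoc]
    rw [h3, ← Matrix.vecMul_vecMul, ← Matrix.vecMul_vecMul, ← Matrix.vecMul_vecMul] at h1
    rw [← h2]
    exact h1
  -- The Gramian of `U` driven by the direction `k` alone; its feedback power is already at least `2
  -- H(A)`.
  obtain ⟨Y₁, hY₁, hY₁eq, hY₁tr⟩ := exists_gramian (fun z hz => (hU0 z hz).le) hδ hβobs
  have hUH := isHurwitz_neg_add_smul_one (fun z hz => (hU0 z hz).le) hδ
  set SU := U + δ • (1 : Matrix (Fin p) (Fin p) ℝ) with hSU
  set E := L * (L' * B * K * D₀) with hE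
  obtain ⟨YE, hYE⟩ := hUH.exists_lyapunov (E * Eᵀ)
  set c := ((L * b)ᵀ * Y₁⁻¹ * YE * Y₁⁻¹ * (L * b)).trace with hc
  -- The weight of the remaining inputs. It cannot be zero: imaginary-axis modes may be reachable
  -- only through them, and `S'` must be invertible.
  obtain ⟨ε, hε, hεc⟩ : ∃ ε : ℝ, 0 < ε ∧ ε ^ 2 * c ≤ η / 2 := by
    refine ⟨Real.sqrt (η / (2 * (|c| + 1))), Real.sqrt_pos.2 (by positivity), ?_⟩
    rw [Real.sq_sqrt (by positivity), div_mul_eq_mul_div, div_le_iff₀ (by positivity)]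
    nlinarith [le_abs_self c]
  set D := D₁ + ε • D₀ with hDdef
  set D' := D₁ + ε⁻¹ • D₀ with hD'def
  have hDD' : D' * D = 1 := by
    rw [hDdef, hD'def, Matrix.add_mul, Matrix.mul_add, Matrix.mul_add, Matrix.smul_mul,
      Matrix.smul_mul, Matrix.mul_smul, Matrix.mul_smul, hD₁₁, hD₁₀, hD₀₁, hD₀₀, smul_zero,
      smul_zero, add_zero, zero_add, smul_smul, inv_mul_cancel₀ hε.ne', one_smul, hD]
  have hK'K : K' * K = 1 := mul_eq_one_comm.1 hKK'
  set S' := K * D with hS'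
  set S := D' * K' with hS
  have hSS' : S * S' = 1 := by
    rw [hS, hS', Matrix.mul_assoc, ← Matrix.mul_assoc K', hK'K, Matrix.one_mul, hDD']
  set V := L' * B * S' with hV
  have hVobs : ∀ (z : ℂ) (w : Fin p' → ℂ), w ≠ 0 → w ᵥ* A'.map Complex.ofReal = z • w →
      w ᵥ* V.map Complex.ofReal ≠ 0 := by
    intro z w hw0 hw h0
    have hz := hA'0 z ((mem_eigenvalues_iff_vecMul A' z).2 ⟨w, hw0, hw⟩)
    refine hF₀.vecMul_ne_zero hz (vecMul_left_inverse_ne_zero hLJ' hw0)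
      (vecMul_intertwine hLA' hw) ?_
    have h1 : L' * B = V * S := by
      rw [hV, Matrix.mul_assoc (L' * B), mul_eq_one_comm.1 hSS', Matrix.mul_one]
    rw [Matrix.vecMul_vecMul, ← map_ofReal_mul, h1, map_ofReal_mul, ← Matrix.vecMul_vecMul, h0,
      Matrix.zero_vecMul]
  obtain ⟨Y, hY, hYeq, hYtr⟩ := exists_gramian hA'0 hδ hVobs
  obtain ⟨hH, hcov⟩ := gramian_feedback hδ hY hYeq
  have hYt : Yᵀ = Y := by
    have := hY.isHermitian.eq
    rwa [Matrix.conjTranspose_eq_transpose_of_trivial] at this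
  have hYdet : IsUnit Y.det := (Matrix.isUnit_iff_isUnit_det _).1 hY.isUnit
  have hZt : (Y⁻¹)ᵀ = Y⁻¹ := by rw [Matrix.transpose_nonsing_inv, hYt]
  set W := Vᵀ * Y⁻¹ * V with hW
  have hWpsd : W.PosSemidef := by
    have := hY.posSemidef.inv.conjTranspose_mul_mul_same V
    rwa [Matrix.conjTranspose_eq_transpose_of_trivial] at this
  have hWtr : W.trace ≤ 2 * topologicalEntropy A + η / 2 := by
    rw [hYtr, htrA', Fintype.card_fin]
    linarith
  have hsplit : W i i + ∑ j ∈ Finset.univ.erase i, W j j = W.trace :=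
    Finset.add_sum_erase _ (fun j => W j j) (Finset.mem_univ i)
  have hrest : 0 ≤ ∑ j ∈ Finset.univ.erase i, W j j :=
    Finset.sum_nonneg fun j _ => hWpsd.diag_nonneg
  -- Both sides solve the same Lyapunov equation for `U + δ`: the noise splits without cross terms
  -- because `D₁ * D₀ = 0`.
  have hLYL : L * Y * Lᵀ = Y₁ + ε ^ 2 • YE := by
    have hLV : L * V * (L * V)ᵀ = L * b * (L * b)ᵀ + ε ^ 2 • (E * Eᵀ) := by
      have h1 : L * V = L * b + ε • E := by
        rw [hV, hb, hE, hS', hDdef]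
        simp only [Matrix.mul_add, Matrix.mul_smul, Matrix.mul_assoc]
      have h2 : L * b * Eᵀ = 0 := by
        have : L * b * Eᵀ = L * (L' * B * K) * (D₁ * D₀) * (L * (L' * B * K))ᵀ := by
          rw [hb, hE, ← Matrix.mul_assoc L (L' * B * K) D₀, Matrix.transpose_mul _ D₀, hD₀t]
          simp only [Matrix.mul_assoc]
        rw [this, hD₁₀, Matrix.mul_zero, Matrix.zero_mul]
      have h3 : E * (L * b)ᵀ = 0 := by
        rw [← Matrix.transpose_transpose (E * (L * b)ᵀ), Matrix.transpose_mul,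
          Matrix.transpose_transpose, h2, Matrix.transpose_zero]
      rw [h1, Matrix.transpose_add, Matrix.transpose_smul, Matrix.add_mul, Matrix.mul_add,
        Matrix.mul_add, Matrix.smul_mul, Matrix.smul_mul, Matrix.mul_smul, Matrix.mul_smul, h2, h3,
        smul_zero, add_zero, zero_add, smul_smul, pow_two]
    have hSL : SU * L = L * (A' + δ • (1 : Matrix (Fin p') (Fin p') ℝ)) := by
      rw [hSU, Matrix.add_mul, Matrix.mul_add, hLA, Matrix.smul_mul, Matrix.mul_smul,
        Matrix.one_mul, Matrix.mul_one]
    have e1 : SU * (L * Y * Lᵀ) + L * Y * Lᵀ * SUᵀ = L * V * (L * V)ᵀ := by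
      have h1 : Lᵀ * SUᵀ = (A' + δ • (1 : Matrix (Fin p') (Fin p') ℝ))ᵀ * Lᵀ := by
        rw [← Matrix.transpose_mul, hSL, Matrix.transpose_mul]
      have h2 : L * V * (L * V)ᵀ = L * (V * Vᵀ) * Lᵀ := by
        rw [Matrix.transpose_mul]; simp only [Matrix.mul_assoc]
      rw [h2, ← hYeq, Matrix.mul_assoc (L * Y), h1, ← Matrix.mul_assoc, ← Matrix.mul_assoc, hSL]
      simp only [Matrix.mul_add, Matrix.add_mul, Matrix.mul_assoc]
    have e3 : SU * YE + YE * SUᵀ = E * Eᵀ := by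
      rwa [Matrix.transpose_neg, Matrix.neg_mul, Matrix.mul_neg, ← neg_add,
        neg_add_eq_zero] at hYE
    rw [← sub_eq_zero]
    refine hUH.eq_zero_of_lyapunov ?_
    have e4 : ∀ T Q : Matrix (Fin p) (Fin p) ℝ,
        T * (Q - (Y₁ + ε ^ 2 • YE)) + (Q - (Y₁ + ε ^ 2 • YE)) * Tᵀ
        = (T * Q + Q * Tᵀ) - (T * Y₁ + Y₁ * Tᵀ) - ε ^ 2 • (T * YE + YE * Tᵀ) := by
      intro T Q
      simp only [Matrix.mul_sub, Matrix.sub_mul, Matrix.mul_add, Matrix.add_mul, Matrix.mul_smul,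
        Matrix.smul_mul, smul_add]
      abel
    rw [Matrix.transpose_neg, Matrix.neg_mul, Matrix.mul_neg, ← neg_add, e4, e1, hY₁eq, e3, hLV]
    simp
  -- Together with `hWtr`, this lower bound forces the other diagonal entries to sum to at most `η`.
  have hWi : 2 * topologicalEntropy A - η / 2 ≤ W i i := by
    have h1 := trace_le_trace_gramian_feedback hY hY₁ hLYL b
    have h2 : V * D₁ = b := by
      rw [hV, hS', hb, hDdef, Matrix.mul_assoc (L' * B), Matrix.mul_assoc K, Matrix.add_mul,
        Matrix.smul_mul, hD₁₁, hD₀₁, smul_zero, add_zero, ← Matrix.mul_assoc]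
    have h3 : (bᵀ * Y⁻¹ * b).trace = W i i := by
      have : bᵀ * Y⁻¹ * b = D₁ * W * D₁ := by
        rw [← h2, hW, Matrix.transpose_mul, hD₁t]
        simp only [Matrix.mul_assoc]
      rw [this, Matrix.trace]
      simp [hD₁, Matrix.mul_diagonal, Matrix.diagonal_mul]
    have h4 : ((L * b)ᵀ * Y₁⁻¹ * (ε ^ 2 • YE) * Y₁⁻¹ * (L * b)).trace = ε ^ 2 * c := by
      rw [hc, Matrix.mul_smul, Matrix.smul_mul, Matrix.smul_mul, Matrix.trace_smul, smul_eq_mul]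
    rw [h3, h4, hY₁tr, htrU] at h1
    have h5 : 0 ≤ 2 * δ * (Fintype.card (Fin p) : ℝ) := by positivity
    linarith
  have hred : L' * (A + B * (S' * -(Vᵀ * Y⁻¹ * L'))) = (A' - V * Vᵀ * Y⁻¹) * L' := by
    rw [Matrix.mul_add, Matrix.sub_mul, hLA', hV]
    simp only [Matrix.mul_neg, Matrix.mul_assoc]
    rw [sub_eq_add_neg]
  refine ⟨-(Vᵀ * Y⁻¹ * L'), S, S', W, hSS', hWpsd, ?_, fun X hX => ?_, by linarith, by linarith⟩
  · have h1 : S' * -(Vᵀ * Y⁻¹ * L') = (-(S' * (Vᵀ * Y⁻¹))) * L' := by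
      simp only [Matrix.mul_neg, Matrix.neg_mul, Matrix.mul_assoc]
    rw [h1]
    refine isHurwitz_of_quotient hLA' hker ?_
    have h2 : A' + L' * B * -(S' * (Vᵀ * Y⁻¹)) = A' - V * Vᵀ * Y⁻¹ := by
      rw [Matrix.mul_neg, ← Matrix.mul_assoc, ← hV, ← Matrix.mul_assoc, sub_eq_add_neg]
    rw [h2]
    exact hH
  · have h1 : (A' - V * Vᵀ * Y⁻¹) * (L' * X * L'ᵀ) + L' * X * L'ᵀ * (A' - V * Vᵀ * Y⁻¹)ᵀ
        + V * Vᵀ = 0 := by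
      have h2 : L'ᵀ * (A' - V * Vᵀ * Y⁻¹)ᵀ
          = (A + B * (S' * -(Vᵀ * Y⁻¹ * L')))ᵀ * L'ᵀ := by
        rw [← Matrix.transpose_mul, ← hred, Matrix.transpose_mul]
      have h3 : V * Vᵀ = L' * (B * S' * (B * S')ᵀ) * L'ᵀ := by
        rw [hV, Matrix.mul_assoc L' B, Matrix.transpose_mul L']
        simp only [Matrix.mul_assoc]
      rw [Matrix.mul_assoc (L' * X), h2, ← Matrix.mul_assoc, ← Matrix.mul_assoc, ← hred]
      generalize A + B * (S' * -(Vᵀ * Y⁻¹ * L')) = M at hX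
      rw [h3]
      have h4 := congrArg (fun Q => L' * Q * L'ᵀ) hX
      simp only [Matrix.mul_zero, Matrix.zero_mul] at h4
      rw [← h4]
      simp only [Matrix.mul_add, Matrix.add_mul, Matrix.mul_assoc]
    -- Since `Vᵀ Y⁻¹ Y Y⁻¹ V = W`, conjugating `L' X L'ᵀ ≤ Y` by `Y⁻¹ V` is exactly `G X Gᵀ ≤ W`.
    have h2 := (hcov _ h1).conjTranspose_mul_mul_same (Y⁻¹ * V)
    rw [Matrix.conjTranspose_eq_transpose_of_trivial] at h2
    convert h2 using 1
    have h3 : (Vᵀ * Y⁻¹ * L')ᵀ = L'ᵀ * (Y⁻¹ * V) := by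
      rw [Matrix.transpose_mul (Vᵀ * Y⁻¹) L', Matrix.transpose_mul Vᵀ Y⁻¹,
        Matrix.transpose_transpose, hZt]
    have h4 : (Y⁻¹ * V)ᵀ = Vᵀ * Y⁻¹ := by rw [Matrix.transpose_mul Y⁻¹ V, hZt]
    rw [Matrix.transpose_neg, Matrix.neg_mul, Matrix.neg_mul, Matrix.mul_neg, neg_neg, h3, h4,
      Matrix.mul_sub, Matrix.sub_mul, Matrix.mul_assoc Vᵀ Y⁻¹ Y,
      Matrix.nonsing_inv_mul _ hYdet, Matrix.mul_one, hW]
    simp only [Matrix.mul_assoc]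

end Feedback


/-! ### Sufficiency, given an input direction -/

open Matrix Filter Topology

theorem topologicalEntropy_nonneg {ι : Type*} [Fintype ι] [DecidableEq ι] (M : Matrix ι ι ℝ) :
    0 ≤ topologicalEntropy M := by
  refine Multiset.sum_nonneg fun x hx => ?_
  obtain ⟨z, hz, rfl⟩ := Multiset.mem_map.1 hx
  exact (Multiset.mem_filter.1 hz).2.le

/-- The encoder is `N^{1/2} Q S` and the decoder `S' Qᵀ N^{-1/2}`, with `QᵀQ = 1`. The `i`-th column
of `Q` has squared entries `capacity / C`, so channel `a` carries power at most about `N_a · (𝔠_a /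
C) · 2H = Pow_a · H / C`, where `𝔠_a` is its capacity. -/
theorem isStabilizableViaAWGN_of_input_direction {n m l : ℕ} (hml : m ≤ l)
    {A : Matrix (Fin n) (Fin n) ℝ} {B : Matrix (Fin n) (Fin m) ℝ}
    (hstab : IsStabilizable A B) {N Pow : Fin l → ℝ} (hN : ∀ i, 0 < N i) (hPow : ∀ i, 0 < Pow i)
    {k : Fin m → ℝ} (hk0 : k ≠ 0)
    (hk : ∀ (z : ℂ) (w : Fin n → ℂ), 0 < z.re → w ≠ 0 → w ᵥ* A.map Complex.ofReal = z • w →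
      (w ᵥ* B.map Complex.ofReal) ⬝ᵥ (fun a => (k a : ℂ)) ≠ 0)
    (hC : topologicalEntropy A < totalCapacity N Pow) : IsStabilizableViaAWGN A B N Pow := by
  obtain ⟨i, -⟩ : ∃ i, k i ≠ 0 := by
    by_contra! h
    exact hk0 (funext h)
  set H := topologicalEntropy A
  set C := totalCapacity N Pow
  have hH0 : 0 ≤ H := topologicalEntropy_nonneg A
  have hC0 : 0 < C := hH0.trans_lt hC
  set t : Fin l → ℝ := fun a => Real.sqrt (capacity (N a) (Pow a) / C) with ht
  have hcap : ∀ a, 0 < capacity (N a) (Pow a) := fun a => by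
    have := hN a
    have := hPow a
    unfold capacity
    positivity
  have ht2 : ∀ a, t a ^ 2 = capacity (N a) (Pow a) / C := fun a =>
    Real.sq_sqrt (div_pos (hcap a) hC0).le
  have htsum : ∑ a, t a ^ 2 = 1 := by
    simp_rw [ht2]
    rw [← Finset.sum_div]
    exact div_self hC0.ne'
  obtain ⟨Q, hQQ, hQi⟩ := exists_orthonormal_columns hml i htsum
  have hQ1 : ∀ a j, Q a j ^ 2 ≤ 1 := by
    intro a j
    have h1 := congrFun (congrFun hQQ j) j
    rw [Matrix.mul_apply, Matrix.one_apply_eq] at h1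
    rw [← h1]
    have h2 := Finset.single_le_sum (f := fun a => Qᵀ j a * Q a j)
      (fun b _ => by rw [Matrix.transpose_apply]; exact mul_self_nonneg _) (Finset.mem_univ a)
    simpa [pow_two] using h2
  -- This choice gives `(1 + θ) H = C - θ`.
  obtain ⟨θ, hθ, hθC⟩ : ∃ θ : ℝ, 0 < θ ∧ (1 + θ) * H < C := by
    refine ⟨(C - H) / (H + 1), div_pos (by linarith) (by linarith), ?_⟩
    have h1 : (1 + (C - H) / (H + 1)) * H = C - (C - H) / (H + 1) := by
      field_simp
      ring
    rw [h1]
    have : 0 < (C - H) / (H + 1) := div_pos (by linarith) (by linarith)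
    linarith
  -- As `η → 0` the left side tends to `Pow a * ((1 + θ) * H / C)`, which is below `Pow a`.
  obtain ⟨η, hη, hηP⟩ : ∃ η : ℝ, 0 < η ∧ ∀ a, N a * ((1 + θ) * t a ^ 2 * (2 * H + η)
      + (1 + θ⁻¹) * m * η) < Pow a := by
    have h1 : ∀ a, ∀ᶠ η in 𝓝[>] (0 : ℝ), N a * ((1 + θ) * t a ^ 2 * (2 * H + η)
        + (1 + θ⁻¹) * m * η) < Pow a := by
      intro a
      have h2 : Tendsto (fun η : ℝ => N a * ((1 + θ) * t a ^ 2 * (2 * H + η)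
          + (1 + θ⁻¹) * m * η)) (𝓝[>] 0)
          (𝓝 (N a * ((1 + θ) * t a ^ 2 * (2 * H + 0) + (1 + θ⁻¹) * m * 0))) := by
        refine (Continuous.tendsto ?_ 0).mono_left nhdsWithin_le_nhds
        fun_prop
      refine h2.eventually_lt_const ?_
      have hNa := hN a
      have hPa := hPow a
      have h3 : N a * ((1 + θ) * t a ^ 2 * (2 * H + 0) + (1 + θ⁻¹) * m * 0)
          = Pow a * ((1 + θ) * H / C) := by
        rw [ht2, capacity]
        field_simp
        ring
      rw [h3]
      exact mul_lt_of_lt_one_right hPa ((div_lt_one hC0).2 hθC)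
    obtain ⟨η, hη1, hη2⟩ := ((eventually_all.2 h1).and self_mem_nhdsWithin).exists
    exact ⟨η, hη2, hη1⟩
  obtain ⟨G, S, S', W, hSS', hW, hcl, hcov, hWi, hWrest⟩ :=
    exists_feedback_of_input_direction hstab i hk0 hk hη
  set D : Matrix (Fin l) (Fin l) ℝ := Matrix.diagonal fun i => Real.sqrt (N i) with hD
  set D' : Matrix (Fin l) (Fin l) ℝ := Matrix.diagonal fun i => (Real.sqrt (N i))⁻¹ with hD'
  have hD'D : D' * D = 1 := by
    rw [hD, hD', Matrix.diagonal_mul_diagonal, ← Matrix.diagonal_one]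
    congr 1; ext i
    exact inv_mul_cancel₀ (Real.sqrt_pos.2 (hN i)).ne'
  have hDt : Dᵀ = D := Matrix.diagonal_transpose _
  have hD't : D'ᵀ = D' := Matrix.diagonal_transpose _
  have hDD : Matrix.diagonal N = D * D := by
    rw [hD, Matrix.diagonal_mul_diagonal]
    congr 1; ext i
    exact (Real.mul_self_sqrt (hN i).le).symm
  have hDD' : D * D' = 1 := mul_eq_one_comm.1 hD'D
  have hRT : S' * Qᵀ * D' * (D * Q * S) = 1 := by
    calc S' * Qᵀ * D' * (D * Q * S) = S' * (Qᵀ * (D' * D) * Q) * S := by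
          simp only [Matrix.mul_assoc]
      _ = 1 := by
        rw [hD'D, Matrix.mul_one, hQQ, Matrix.mul_one, mul_eq_one_comm.1 hSS']
  have hclosed : closedLoop A B (S' * G) (D * Q * S) (S' * Qᵀ * D') = A + B * (S' * G) := by
    rw [closedLoop, Matrix.mul_assoc B, hRT, Matrix.mul_one]
  refine ⟨S' * G, D * Q * S, S' * Qᵀ * D', hRT, by rw [hclosed]; exact hcl, fun a => ?_⟩
  have hnoise : B * (S' * Qᵀ * D') * Matrix.diagonal N * (B * (S' * Qᵀ * D'))ᵀ
      = B * S' * (B * S')ᵀ := by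
    have h1 : (B * (S' * Qᵀ * D'))ᵀ = D' * Q * (B * S')ᵀ := by
      simp only [Matrix.transpose_mul, Matrix.transpose_transpose, hD't, Matrix.mul_assoc]
    rw [h1, hDD]
    calc _ = B * S' * (Qᵀ * ((D' * D) * (D * D')) * Q) * (B * S')ᵀ := by
          simp only [Matrix.mul_assoc]
      _ = _ := by rw [hD'D, hDD', Matrix.mul_one, Matrix.mul_one, hQQ, Matrix.mul_one]
  obtain ⟨X, hX⟩ := hcl.exists_lyapunov (B * S' * (B * S')ᵀ)
  have hpow := inputPower_eq (by rw [hclosed]; exact hcl) N (X := X)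
    (by rw [hclosed, hnoise]; exact hX) a
  rw [hpow]
  have hTF : D * Q * S * (S' * G) = D * (Q * G) := by
    rw [Matrix.mul_assoc (D * Q), ← Matrix.mul_assoc S, hSS', Matrix.one_mul, Matrix.mul_assoc]
  have h1 : (D * Q * S * (S' * G) * X * (D * Q * S * (S' * G))ᵀ) a a
      = N a * (Q * (G * X * Gᵀ) * Qᵀ) a a := by
    have h2 : D * Q * S * (S' * G) * X * (D * Q * S * (S' * G))ᵀ
        = D * (Q * (G * X * Gᵀ) * Qᵀ) * D := by
      rw [hTF, Matrix.transpose_mul, Matrix.transpose_mul, hDt]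
      simp only [Matrix.mul_assoc]
    rw [h2, hD, Matrix.mul_diagonal, Matrix.diagonal_mul]
    have := Real.mul_self_sqrt (hN a).le
    linear_combination (Q * (G * X * Gᵀ) * Qᵀ) a a * this
  have h3 : (Q * (G * X * Gᵀ) * Qᵀ) a a ≤ (Q * W * Qᵀ) a a := by
    have h4 := ((hcov X hX).mul_mul_conjTranspose_same Q).diag_nonneg (i := a)
    rw [Matrix.conjTranspose_eq_transpose_of_trivial, Matrix.mul_sub, Matrix.sub_mul,
      Matrix.sub_apply] at h4
    linarith
  have h5 : (Q * W * Qᵀ) a a = Q a ⬝ᵥ (W *ᵥ Q a) := by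
    rw [Matrix.mul_assoc]
    simp [Matrix.mul_apply, dotProduct, Matrix.mulVec]
  have h6 := posSemidef_quadratic_le hW i (hQ1 a) hθ
  rw [h1]
  refine lt_of_le_of_lt (mul_le_mul_of_nonneg_left (h3.trans ?_) (hN a).le) (hηP a)
  rw [h5]
  refine h6.trans ?_
  rw [hQi]
  gcongr


/-! ### Cyclic matrices and generic input directions -/

open Matrix Polynomial

section Cyclic

variable {κ : Type*} [Fintype κ] [DecidableEq κ]

/-- Two independent left null vectors combine to a nonzero one with vanishing `j`-th coordinate. It
remains a null vector when row `j` is replaced, so every cofactor vanishes. -/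
theorem adjugate_eq_zero_of_vecMul {S : Matrix κ κ ℂ} {v w : κ → ℂ} (hv0 : v ≠ 0)
    (hv : v ᵥ* S = 0) (hw : w ᵥ* S = 0) (hvw : ∀ c : ℂ, w ≠ c • v) : S.adjugate = 0 := by
  ext a j
  have key : ∃ u : κ → ℂ, u ≠ 0 ∧ u ᵥ* S = 0 ∧ u j = 0 := by
    by_cases hj : v j = 0
    · exact ⟨v, hv0, hv, hj⟩
    · refine ⟨w - (w j / v j) • v, sub_ne_zero.2 (hvw _), ?_, ?_⟩
      · rw [Matrix.sub_vecMul, Matrix.smul_vecMul, hv, hw, smul_zero, sub_zero]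
      · simp [hj]
  obtain ⟨u, hu0, hu, huj⟩ := key
  rw [Matrix.adjugate_apply, Matrix.zero_apply, ← Matrix.exists_vecMul_eq_zero_iff]
  refine ⟨u, hu0, ?_⟩
  rw [← hu]
  ext b
  simp only [Matrix.vecMul, dotProduct]
  refine Finset.sum_congr rfl fun c _ => ?_
  by_cases hc : c = j
  · rw [hc, huj, zero_mul, zero_mul]
  · rw [Matrix.updateRow_ne hc]

/-- Cayley–Hamilton with one factor fewer: `X - z` divides every entry of the adjugate of `X - S`,
so it cancels from `adj(X - S) (X - S) = charpoly`. Evaluating the quotient identity at `S` gives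
`g(S) = 0`. -/
theorem exists_monic_aeval_eq_zero_of_adjugate {S : Matrix κ κ ℂ} {z : ℂ}
    (hadj : (z • (1 : Matrix κ κ ℂ) - S).adjugate = 0)
    (hz : (z • (1 : Matrix κ κ ℂ) - S).det = 0) :
    ∃ g : ℂ[X], g.Monic ∧ g.natDegree + 1 = Fintype.card κ ∧ aeval S g = 0 := by
  have hscalar : (charmatrix S).map (eval z) = z • (1 : Matrix κ κ ℂ) - S := by
    ext a b
    by_cases hab : a = b
    · subst hab; simp [charmatrix_apply_eq]
    · simp [hab]
  have hroot : S.charpoly.IsRoot z := by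
    rw [IsRoot, Matrix.eval_charpoly, Matrix.scalar_apply, ← Matrix.smul_one_eq_diagonal, hz]
  obtain ⟨g, hg⟩ := dvd_iff_isRoot.2 hroot
  have hgm : g.Monic := by
    refine (monic_X_sub_C z).of_mul_monic_left ?_
    rw [← hg]; exact S.charpoly_monic
  have hdeg : g.natDegree + 1 = Fintype.card κ := by
    rw [← S.charpoly_natDegree_eq_dim, hg, (monic_X_sub_C z).natDegree_mul hgm, natDegree_X_sub_C,
      add_comm]
  refine ⟨g, hgm, hdeg, ?_⟩
  have hdvd : ∀ a b, X - C z ∣ (charmatrix S).adjugate a b := by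
    intro a b
    rw [dvd_iff_isRoot, IsRoot]
    have h1 := RingHom.map_adjugate (evalRingHom z) (charmatrix S)
    rw [RingHom.mapMatrix_apply, RingHom.mapMatrix_apply, coe_evalRingHom, hscalar, hadj] at h1
    exact congrFun (congrFun h1 a) b
  choose Q hQ using hdvd
  have hQ' : (charmatrix S).adjugate = (X - C z) • Matrix.of Q := by
    ext1 a b
    rw [hQ, Matrix.smul_apply, Matrix.of_apply, smul_eq_mul]
  have h1 : g • (1 : Matrix κ κ ℂ[X]) = Matrix.of Q * charmatrix S := by
    have h2 := Matrix.adjugate_mul (charmatrix S)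
    rw [hQ', Matrix.smul_mul] at h2
    have h3 : (charmatrix S).det = (X - C z) * g := hg
    rw [h3, mul_smul] at h2
    exact (smul_right_injective _ (X_sub_C_ne_zero z) h2).symm
  apply_fun matPolyEquiv at h1
  simp only [map_mul, matPolyEquiv_charmatrix] at h1
  apply_fun fun p => p.eval S at h1
  rw [eval_mul_X_sub_C, matPolyEquiv_smul_one, eval_map] at h1
  exact h1

/-- The left eigenspaces of a cyclic matrix are at most one-dimensional. -/
theorem IsCyclicMatrix.exists_eq_smul {M : Matrix κ κ ℝ} (hM : IsCyclicMatrix M) {z : ℂ}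
    {v w : κ → ℂ} (hv0 : v ≠ 0) (hv : v ᵥ* M.map Complex.ofReal = z • v)
    (hw : w ᵥ* M.map Complex.ofReal = z • w) : ∃ c : ℂ, w = c • v := by
  by_contra! hvw
  have key : ∀ u : κ → ℂ, u ᵥ* M.map Complex.ofReal = z • u →
      u ᵥ* (z • (1 : Matrix κ κ ℂ) - M.map Complex.ofReal) = 0 := by
    intro u hu
    rw [Matrix.vecMul_sub, Matrix.vecMul_smul, Matrix.vecMul_one, hu, sub_self]
  have hadj := adjugate_eq_zero_of_vecMul hv0 (key v hv) (key w hw) hvw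
  obtain ⟨g, hgm, hdeg, hg⟩ := exists_monic_aeval_eq_zero_of_adjugate hadj
    (Matrix.exists_vecMul_eq_zero_iff.1 ⟨v, hv0, key v hv⟩)
  set d := g.natDegree with hd
  -- As `M` is real, taking real parts of the coefficients of `g` keeps the annihilation, and the
  -- leading coefficient `1` keeps `r` nonzero. Its degree is too small for the minimal polynomial
  -- of a cyclic matrix.
  set r : ℝ[X] := ∑ k ∈ Finset.range (d + 1), C (g.coeff k).re * X ^ k with hr
  have hr0 : r ≠ 0 := by
    intro h0
    have h1 : r.coeff d = 1 := by
      rw [hr, finsetSum_coeff]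
      simp only [coeff_C_mul_X_pow]
      rw [Finset.sum_ite_eq, if_pos (by simp), hd, hgm.coeff_natDegree, Complex.one_re]
    rw [h0, coeff_zero] at h1
    exact zero_ne_one h1
  have hrM : aeval M r = 0 := by
    ext a b
    have h1 := congrArg Complex.re (congrFun (congrFun hg a) b)
    rw [aeval_eq_sum_range, Matrix.sum_apply, Complex.re_sum] at h1
    rw [hr, map_sum, Matrix.sum_apply]
    simp only [Matrix.zero_apply, Complex.zero_re] at h1
    rw [Matrix.zero_apply, ← h1]
    refine Finset.sum_congr rfl fun k _ => ?_
    have hpow : (M.map Complex.ofReal) ^ k = (M ^ k).map Complex.ofReal :=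
      (Matrix.map_pow M Complex.ofRealHom k).symm
    rw [hpow, map_mul, map_pow, aeval_C, aeval_X, ← Algebra.smul_def, Matrix.smul_apply,
      Matrix.smul_apply, Matrix.map_apply, smul_eq_mul, smul_eq_mul, Complex.re_mul_ofReal]
  have hdeg1 : (minpoly ℝ M).natDegree ≤ r.natDegree :=
    natDegree_le_natDegree (minpoly.degree_le_of_ne_zero ℝ M hr0 hrM)
  have hdeg2 : r.natDegree ≤ d := by
    refine natDegree_sum_le_of_forall_le _ _ fun k hk => (natDegree_C_mul_X_pow_le _ _).trans ?_
    exact Nat.lt_succ_iff.1 (Finset.mem_range.1 hk)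
  have hdeg3 : (minpoly ℝ M).natDegree = Fintype.card κ := hM
  omega

end Cyclic

section CyclicDecomposition

variable {n : ℕ} {A : Matrix (Fin n) (Fin n) ℝ} (D : CyclicDecomposition A)

theorem CyclicDecomposition.vecMul_blockDiagonal_iff (u : (Σ i, Fin (D.dim i)) → ℂ) (z : ℂ) :
    u ᵥ* (Matrix.blockDiagonal' D.block).map Complex.ofReal = z • u ↔
      ∀ i, (fun a => u ⟨i, a⟩) ᵥ* (D.block i).map Complex.ofReal = z • fun a => u ⟨i, a⟩ := by
  have h : ∀ i a, (u ᵥ* (Matrix.blockDiagonal' D.block).map Complex.ofReal) ⟨i, a⟩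
      = ((fun a => u ⟨i, a⟩) ᵥ* (D.block i).map Complex.ofReal) a := by
    intro i a
    simp only [Matrix.vecMul, dotProduct, Matrix.map_apply]
    rw [Fintype.sum_sigma, Finset.sum_eq_single i]
    · simp only [Matrix.blockDiagonal'_apply_eq]
    · intro j _ hj
      refine Finset.sum_eq_zero fun b _ => ?_
      rw [Matrix.blockDiagonal'_apply_ne _ _ _ hj, Complex.ofReal_zero, mul_zero]
    · intro hi; exact absurd (Finset.mem_univ i) hi
  constructor
  · intro hu i
    ext a
    rw [← h, hu]; rfl
  · intro hu
    ext ⟨i, a⟩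
    rw [h, hu]; rfl

theorem CyclicDecomposition.vecMul_P {w : Fin n → ℂ} {z : ℂ}
    (hw : w ᵥ* A.map Complex.ofReal = z • w) :
    (w ᵥ* D.P.map Complex.ofReal) ᵥ* (Matrix.blockDiagonal' D.block).map Complex.ofReal
      = z • (w ᵥ* D.P.map Complex.ofReal) := by
  have h1 : D.P * Matrix.blockDiagonal' D.block = A * D.P := by
    rw [← D.similar, ← Matrix.mul_assoc, ← Matrix.mul_assoc, D.P_mul_Pinv, Matrix.one_mul]
  rw [Matrix.vecMul_vecMul, ← map_ofReal_mul, h1, map_ofReal_mul, ← Matrix.vecMul_vecMul, hw,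
    Matrix.smul_vecMul]

theorem CyclicDecomposition.vecMul_Pinv {u : (Σ i, Fin (D.dim i)) → ℂ} {z : ℂ}
    (hu : u ᵥ* (Matrix.blockDiagonal' D.block).map Complex.ofReal = z • u) :
    (u ᵥ* D.Pinv.map Complex.ofReal) ᵥ* A.map Complex.ofReal
      = z • (u ᵥ* D.Pinv.map Complex.ofReal) := by
  have h1 : D.Pinv * A = Matrix.blockDiagonal' D.block * D.Pinv := by
    rw [← D.similar, Matrix.mul_assoc (D.Pinv * A), D.P_mul_Pinv, Matrix.mul_one]
  rw [Matrix.vecMul_vecMul, ← map_ofReal_mul, h1, map_ofReal_mul, ← Matrix.vecMul_vecMul, hu,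
    Matrix.smul_vecMul]

/-- If only the first block is unstable, the left eigenspaces of the strictly unstable eigenvalues
are at most one-dimensional. -/
theorem CyclicDecomposition.OnlyFirstBlockUnstable.exists_eq_smul
    {D : CyclicDecomposition A} (hD : D.OnlyFirstBlockUnstable) {z : ℂ} (hz : 0 < z.re)
    {v w : Fin n → ℂ} (hv0 : v ≠ 0) (hv : v ᵥ* A.map Complex.ofReal = z • v)
    (hw : w ᵥ* A.map Complex.ofReal = z • w) : ∃ c : ℂ, w = c • v := by
  have hzero : ∀ x : Fin n → ℂ, x ᵥ* A.map Complex.ofReal = z • x → ∀ i, i ≠ 0 →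
      (fun a => (x ᵥ* D.P.map Complex.ofReal) ⟨i, a⟩) = 0 := by
    intro x hx i hi
    by_contra h0
    have h1 := (D.vecMul_blockDiagonal_iff _ z).1 (D.vecMul_P hx) i
    exact absurd (hD.2 i hi z ((mem_eigenvalues_iff_vecMul _ z).2 ⟨_, h0, h1⟩)) (not_le.2 hz)
  have hext : ∀ x : Fin n → ℂ, x ᵥ* A.map Complex.ofReal = z • x →
      (fun a => (x ᵥ* D.P.map Complex.ofReal) ⟨0, a⟩) = 0 → x = 0 := by
    intro x hx h0
    by_contra hx0
    refine vecMul_left_inverse_ne_zero D.P_mul_Pinv hx0 ?_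
    ext ⟨i, a⟩
    by_cases hi : i = 0
    · subst hi; exact congrFun h0 a
    · exact congrFun (hzero x hx i hi) a
  obtain ⟨c, hc⟩ := (D.cyclic 0).exists_eq_smul (fun h0 => hv0 (hext v hv h0))
    ((D.vecMul_blockDiagonal_iff _ z).1 (D.vecMul_P hv) 0)
    ((D.vecMul_blockDiagonal_iff _ z).1 (D.vecMul_P hw) 0)
  refine ⟨c, sub_eq_zero.1 (hext (w - c • v) ?_ ?_)⟩
  · rw [Matrix.sub_vecMul, Matrix.smul_vecMul, hv, hw, smul_sub, smul_comm]
  · ext a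
    have := congrFun hc a
    simp only [Pi.smul_apply] at this
    rw [Matrix.sub_vecMul, Matrix.smul_vecMul, Pi.sub_apply, this]
    simp

theorem CyclicDecomposition.minpoly_dvd_zero (i : Fin (D.k + 1)) :
    minpoly ℝ (D.block i) ∣ minpoly ℝ (D.block 0) := by
  induction i using Fin.induction with
  | zero => exact dvd_rfl
  | succ i ih => exact (D.minpoly_dvd i).trans ih

theorem CyclicDecomposition.not_isHurwitz_block_zero (hA : ¬ IsHurwitz A) :
    ¬ IsHurwitz (D.block 0) := by
  refine fun h => hA fun z hz => h z ?_
  rw [mem_eigenvalues_iff_aeval_minpoly] at hz ⊢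
  rwa [D.minpoly_zero]

/-- An eigenvalue of a later block is also one of block `0`, by divisibility, so `A` has two
independent left eigenvectors for it. With a single input column some nontrivial combination of them
annihilates `B`, against the PBH test if the eigenvalue is not stable. -/
theorem CyclicDecomposition.isHurwitz_block_of_single_input {B : Matrix (Fin n) (Fin 1) ℝ}
    (hstab : IsStabilizable A B) {i : Fin (D.k + 1)} (hi : i ≠ 0) : IsHurwitz (D.block i) := by
  obtain ⟨F, hF⟩ := hstab
  intro z hz
  by_contra hre
  rw [not_lt] at hre
  have hz0 : z ∈ eigenvalues (D.block 0) := by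
    rw [mem_eigenvalues_iff_aeval_minpoly] at hz ⊢
    obtain ⟨q, hq⟩ := D.minpoly_dvd_zero i
    rw [hq, map_mul, hz, zero_mul]
  have key : ∀ j, z ∈ eigenvalues (D.block j) → ∃ u : (Σ i, Fin (D.dim i)) → ℂ,
      u ᵥ* (Matrix.blockDiagonal' D.block).map Complex.ofReal = z • u ∧
      (∃ a, u ⟨j, a⟩ ≠ 0) ∧ ∀ k a, k ≠ j → u ⟨k, a⟩ = 0 := by
    intro j hj
    obtain ⟨v, hv0, hv⟩ := (mem_eigenvalues_iff_vecMul _ z).1 hj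
    let u : (Σ i, Fin (D.dim i)) → ℂ := fun x =>
      if h : x.1 = j then v (Fin.cast (congrArg D.dim h) x.2) else 0
    have huj : (fun a => u ⟨j, a⟩) = v := by ext a; simp [u]
    have huk : ∀ k, k ≠ j → (fun a => u ⟨k, a⟩) = 0 := by
      intro k hk; ext a; simp [u, hk]
    refine ⟨u, (D.vecMul_blockDiagonal_iff u z).2 fun k => ?_, ?_, fun k a hk =>
      congrFun (huk k hk) a⟩
    · by_cases hk : k = j
      · subst hk; rw [huj, hv]
      · rw [huk k hk, Matrix.zero_vecMul, smul_zero]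
    · obtain ⟨a, ha⟩ := Function.ne_iff.1 hv0
      exact ⟨a, by rw [congrFun huj a]; exact ha⟩
  obtain ⟨u₀, hu₀, ⟨a₀, ha₀⟩, hu₀'⟩ := key 0 hz0
  obtain ⟨u, hu, ⟨a, ha⟩, hu'⟩ := key i hz
  set f : ((Σ i, Fin (D.dim i)) → ℂ) → ℂ := fun x =>
    ((x ᵥ* D.Pinv.map Complex.ofReal) ᵥ* B.map Complex.ofReal) 0 with hf
  have hne : ∀ x : (Σ i, Fin (D.dim i)) → ℂ, x ≠ 0 →
      x ᵥ* (Matrix.blockDiagonal' D.block).map Complex.ofReal = z • x → f x ≠ 0 := by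
    intro x hx0 hx h0
    refine hF.vecMul_ne_zero hre (vecMul_left_inverse_ne_zero D.Pinv_mul_P hx0)
      (D.vecMul_Pinv hx) ?_
    ext j
    rw [Subsingleton.elim j 0]
    exact h0
  have hu₀0 : u₀ ≠ 0 := fun h => ha₀ (by rw [h]; rfl)
  have hfu₀ := hne u₀ hu₀0 hu₀
  refine hne (f u₀ • u - f u • u₀) ?_ ?_ ?_
  · intro h
    have := congrFun h ⟨i, a⟩
    simp [hu₀' i a hi, hfu₀, ha] at this
  · rw [Matrix.sub_vecMul, Matrix.smul_vecMul, Matrix.smul_vecMul, hu, hu₀, smul_sub,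
      smul_comm z, smul_comm z]
  · simp only [hf, Matrix.sub_vecMul, Matrix.smul_vecMul, Pi.sub_apply, Pi.smul_apply, smul_eq_mul]
    ring

end CyclicDecomposition

/-- If the left eigenspaces of the strictly unstable eigenvalues are at most one-dimensional, a
single generic input direction controls all strictly unstable modes. -/
theorem exists_input_direction {n m : ℕ} (hm : 0 < m) {A : Matrix (Fin n) (Fin n) ℝ}
    {B : Matrix (Fin n) (Fin m) ℝ} (hstab : IsStabilizable A B)
    (hdim : ∀ (z : ℂ) (v w : Fin n → ℂ), 0 < z.re → v ≠ 0 → v ᵥ* A.map Complex.ofReal = z • v →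
      w ᵥ* A.map Complex.ofReal = z • w → ∃ c : ℂ, w = c • v) :
    ∃ k : Fin m → ℝ, k ≠ 0 ∧ ∀ (z : ℂ) (w : Fin n → ℂ), 0 < z.re → w ≠ 0 →
      w ᵥ* A.map Complex.ofReal = z • w →
      (w ᵥ* B.map Complex.ofReal) ⬝ᵥ (fun a => (k a : ℂ)) ≠ 0 := by
  classical
  obtain ⟨F, hF⟩ := hstab
  let φ : (Fin m → ℂ) → ((Fin m → ℝ) →ₗ[ℝ] ℂ) := fun b =>
    { toFun := fun k => b ⬝ᵥ fun a => (k a : ℂ)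
      map_add' := by
        intro x y
        simp [dotProduct, mul_add, Finset.sum_add_distrib]
      map_smul' := by
        intro c x
        simp only [dotProduct, Pi.smul_apply, smul_eq_mul, Complex.ofReal_mul, RingHom.id_apply,
          Complex.real_smul, Finset.mul_sum]
        exact Finset.sum_congr rfl fun a _ => by ring }
  have hφ : ∀ b, b ≠ 0 → LinearMap.ker (φ b) ≠ ⊤ := by
    intro b hb h
    obtain ⟨a, ha⟩ := Function.ne_iff.1 hb
    have h1 : Pi.single a 1 ∈ LinearMap.ker (φ b) := by rw [h]; trivial
    refine ha ?_
    have h2 : (b ⬝ᵥ fun c => ((Pi.single a 1 : Fin m → ℝ) c : ℂ)) = 0 := h1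
    have h3 : (fun c => ((Pi.single a 1 : Fin m → ℝ) c : ℂ)) = Pi.single a 1 := by
      ext c
      by_cases hc : c = a
      · subst hc; simp
      · simp [hc]
    rwa [h3, dotProduct_single, mul_one] at h2
  have hev : ∀ z : ℂ, ∃ w : Fin n → ℂ, z ∈ eigenvalues A →
      w ≠ 0 ∧ w ᵥ* A.map Complex.ofReal = z • w := by
    intro z
    by_cases hz : z ∈ eigenvalues A
    · obtain ⟨w, hw⟩ := (mem_eigenvalues_iff_vecMul A z).1 hz
      exact ⟨w, fun _ => hw⟩
    · exact ⟨0, fun h => absurd h hz⟩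
  choose e he using hev
  -- The bad directions, one proper real subspace per strictly unstable eigenvalue; `⊥` is added to
  -- force `k ≠ 0`. Finitely many proper subspaces do not cover `ℝ^m`.
  set s : Finset (Submodule ℝ (Fin m → ℝ)) := insert ⊥
    (((eigenvalues A).toFinset.filter fun z => 0 < z.re).image fun z =>
      LinearMap.ker (φ (e z ᵥ* B.map Complex.ofReal))) with hs
  have htop : ⊤ ∉ s := by
    rw [hs, Finset.mem_insert, not_or, Finset.mem_image]
    constructor
    · have : Nonempty (Fin m) := ⟨⟨0, hm⟩⟩
      exact top_ne_bot
    · rintro ⟨z, hz, h⟩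
      rw [Finset.mem_filter, Multiset.mem_toFinset] at hz
      obtain ⟨h1, h2⟩ := he z hz.1
      exact hφ _ (hF.vecMul_ne_zero hz.2.le h1 h2) h
  have hcov := Subspace.biUnion_ne_univ_of_top_notMem htop
  obtain ⟨k, hk⟩ := (Set.ne_univ_iff_exists_notMem _).1 hcov
  simp only [Set.mem_iUnion, not_exists, SetLike.mem_coe] at hk
  refine ⟨k, fun h => hk ⊥ (Finset.mem_insert_self _ _) (by rw [h]; exact Submodule.zero_mem _),
    fun z w hz hw0 hw h0 => ?_⟩
  have hzA : z ∈ eigenvalues A := (mem_eigenvalues_iff_vecMul A z).2 ⟨w, hw0, hw⟩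
  -- The eigenspace is a line, so avoiding the kernel of the chosen eigenvector `e z` handles every
  -- eigenvector `w`.
  obtain ⟨c, hc⟩ := hdim z w (e z) hz hw0 hw (he z hzA).2
  refine hk (LinearMap.ker (φ (e z ᵥ* B.map Complex.ofReal))) ?_ ?_
  · exact Finset.mem_insert_of_mem (Finset.mem_image.2 ⟨z, by simp [hzA, hz], rfl⟩)
  · change (e z ᵥ* B.map Complex.ofReal) ⬝ᵥ (fun a => (k a : ℂ)) = 0
    rw [hc, Matrix.smul_vecMul, smul_dotProduct, h0, smul_zero]

theorem input_dim_pos {n m : ℕ} {A : Matrix (Fin n) (Fin n) ℝ} {B : Matrix (Fin n) (Fin m) ℝ}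
    (hA : ¬ IsHurwitz A) (hstab : IsStabilizable A B) : 0 < m := by
  obtain ⟨F, hF⟩ := hstab
  rcases Nat.eq_zero_or_pos m with rfl | h
  · refine absurd ?_ hA
    have : B * F = 0 := by ext i j; simp [Matrix.mul_apply]
    rwa [this, add_zero] at hF
  · exact h

end MIMOControl

/-! ### The two equivalences -/

theorem corollary1 {n m l : ℕ} (hml : m ≤ l)
    (A : Matrix (Fin n) (Fin n) ℝ) (B : Matrix (Fin n) (Fin m) ℝ)
    (hunstable : ¬ IsHurwitz A) (hstab : IsStabilizable A B)
    (N Pow : Fin l → ℝ) (hN : ∀ i, 0 < N i) (hPow : ∀ i, 0 < Pow i) :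
    (∀ D : CyclicDecomposition A, D.OnlyFirstBlockUnstable →
      (IsStabilizableViaAWGN A B N Pow ↔ topologicalEntropy A < totalCapacity N Pow)) ∧
    (m = 1 →
      (∀ D : CyclicDecomposition A,
        ¬ IsHurwitz (D.block 0) ∧ ∀ i, i ≠ 0 → IsHurwitz (D.block i)) ∧
      (IsStabilizableViaAWGN A B N Pow ↔ topologicalEntropy A < totalCapacity N Pow)) := by
  have hm := input_dim_pos hunstable hstab
  have hl : 0 < l := hm.trans_le hml
  refine ⟨fun D hD => ⟨topologicalEntropy_lt_totalCapacity hl hN, fun hC => ?_⟩, ?_⟩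
  · obtain ⟨k, hk0, hk⟩ := exists_input_direction hm hstab
      fun z v w hz hv0 hv hw => hD.exists_eq_smul hz hv0 hv hw
    exact isStabilizableViaAWGN_of_input_direction hml hstab hN hPow hk0 hk hC
  · rintro rfl
    refine ⟨fun D => ⟨D.not_isHurwitz_block_zero hunstable,
      fun i hi => D.isHurwitz_block_of_single_input hstab hi⟩,
      topologicalEntropy_lt_totalCapacity hl hN, fun hC => ?_⟩
    -- With one input the pairing with `k = 1` is the only entry of `w B`, so the PBH test is the
    -- required condition.
    refine isStabilizableViaAWGN_of_input_direction hml hstab hN hPow (k := 1) one_ne_zero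
      (fun z w hz hw0 hw h0 => ?_) hC
    obtain ⟨F, hF⟩ := hstab
    refine hF.vecMul_ne_zero hz.le hw0 hw ?_
    ext j
    rw [Subsingleton.elim j 0]
    simpa [dotProduct] using h0
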